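/- Let $\alpha\in[0,2)$. Put $\kappa_\alpha=\frac{2-\alpha}{2}$ and $\beta_\alpha=\frac{\alpha-1}{2-\alpha}$, let $J_\nu$ be the Bessel function of the first kind of order $\nu$, and let $j_{n}$ ($n\ge 1$) be the $n$-th positive zero of $J_{\beta_\alpha+1}$. Let $\lambda_{\alpha,n}$, $\Phi_{\alpha,n}$ be the eigenvalues and eigenfunctions of $-(x^\alpha u')'$ on $(0,1)$ with boundary conditions $(x^\alpha u')(0)=0$, $u'(1)=0$, that is, $\lambda_{\alpha,0}=0$, $\Phi_{\alpha,0}=1$ and, for $n\ge1$, $$\lambda_{\alpha,n}=\kappa_\alpha^2 j_n^2,\qquad \Phi_{\alpha,n}(x)=K_{\alpha,n}\,x^{\frac{1-\alpha}{2}}J_{\beta_\alpha}\bigl(j_n x^{\frac{2-\alpha}{2}}\bigr),$$ where $K_{\alpha,n}>0$ is such that $\|\Phi_{\alpha,n}\|_{L^2(0,1)}=1$. Put $\lambda^*_{0}=1$ and $\lambda^*_{n}=\lambda_{\alpha,n}$ for $n\ge1$. Let $H^1_\alpha(0,1)$ be the space of real functions $u\in L^2(0,1)$ that are absolutely continuous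 on $[0,1]$ if $\alpha<1$, locally absolutely continuous in $(0,1]$ if $\alpha\ge1$, with $x^{\alpha/2}u_x\in L^2(0,1)$; let $H^2_\alpha(0,1)=\{u\in H^1_\alpha(0,1): x^\alpha u_x\in H^1(0,1)\}$; and let $$V^2_\alpha=\begin{cases}\{\mu\in H^2_\alpha(0,1): x^{\alpha/2}\mu_x\in L^\infty(0,1)\}, & \alpha\in[0,1),\\ \{\mu\in H^2_\alpha(0,1): x^{\alpha/2}\mu_x\in L^\infty(0,1),\ (x^\alpha\mu_x)_x\in L^\infty(0,1)\}, & \alpha\in[1,2),\end{cases}$$ with its natural norm $$\|\mu\|_{V^2_\alpha}=\|\mu\|_{L^2}+\|x^{\alpha/2}\mu_x\|_{L^2}+\|(x^\alpha\mu_x)_x\|_{L^2}+\|x^{\alpha/2}\mu_x\|_{L^\infty}\quad\bigl(+\,\|(x^\alpha\mu_x)_x\|_{L^\infty}\text{ if }\alpha\ge1\bigr).$$ The class of admissible potentials is $$V^{(adm)}=\Bigl\{\mu\in V^2_\alpha:\ \exists c>0\ \forall n\ge0,\ |\langle\mu,\Phi_{\alpha,n}\rangle_{L^2(0,1)}|\ge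 \frac{c}{\lambda^*_n}\Bigr\}.$$ Then the function $\mu(x)=x^{2-\alpha}$ belongs to $V^{(adm)}$; explicitly, for all $n\ge1$, $$|\langle\mu,\Phi_{\alpha,n}\rangle_{L^2(0,1)}|=\frac{(2-\alpha)^{3/2}}{\lambda_{\alpha,n}}.$$ Moreover, $V^{(adm)}$ is dense in $V^2_\alpha$. -/

import Mathlib

open MeasureTheory

namespace DegenerateWave

/-! ### Spectral data of `-(x^α u')'` on `(0,1)` with Neumann boundary conditions -/

/-- The Bessel function of the first kind of real order `ν`, at `x > 0`:
`J_ν(x) = ∑_m (-1)^m / (m! Γ(m+ν+1)) (x/2)^(2m+ν)`. -/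
noncomputable def besselJ (ν x : ℝ) : ℝ :=
  ∑' m : ℕ, (-1 : ℝ) ^ m / ((Nat.factorial m : ℝ) * Real.Gamma ((m : ℝ) + ν + 1))
    * (x / 2) ^ (2 * (m : ℝ) + ν)

/-- For `n ≥ 1`, `besselZero ν n` is the `n`-th positive zero of `J_ν` (in increasing order):
each zero is the smallest one beyond the previous one, starting from `0`. -/
noncomputable def besselZero (ν : ℝ) : ℕ → ℝ
  | 0 => 0
  | n + 1 => sInf {x : ℝ | besselZero ν n < x ∧ besselJ ν x = 0}

/-- `κ_α = (2-α)/2`. -/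
noncomputable def kappa (α : ℝ) : ℝ := (2 - α) / 2

/-- The order of the Bessel function in the eigenfunctions. It is `-ν_α` with
`ν_α = (1-α)/(2-α)` if `α ∈ [0,1)`, and `ν_α = (α-1)/(2-α)` if `α ∈ [1,2)`; in both cases this is
`(α-1)/(2-α)`. -/
noncomputable def order (α : ℝ) : ℝ := (α - 1) / (2 - α)

/-- The eigenvalues `λ_{α,n}`: `λ_{α,0} = 0` and, for `n ≥ 1`, `λ_{α,n} = κ_α² j²`, with `j` the
`n`-th positive zero of the Bessel function of order `order α + 1`. -/
noncomputable def eigenvalue (α : ℝ) (n : ℕ) : ℝ :=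
  if n = 0 then 0 else kappa α ^ 2 * besselZero (order α + 1) n ^ 2

/-- `λ*_{α,0} = 1`, and `λ*_{α,n} = λ_{α,n}` for `n ≥ 1`. -/
noncomputable def eigenvalueStar (α : ℝ) (n : ℕ) : ℝ :=
  if n = 0 then 1 else eigenvalue α n

/-- The eigenfunction for `λ_{α,n}`, `n ≥ 1`, before normalization. -/
noncomputable def rawEigenfunction (α : ℝ) (n : ℕ) (x : ℝ) : ℝ :=
  x ^ ((1 - α) / 2) *
    besselJ (order α) (besselZero (order α + 1) n * x ^ ((2 - α) / 2))

/-- The normalizing constant `K_{α,n} > 0`, for which `Φ_{α,n}` has norm `1` in `L²(0,1)`. -/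
noncomputable def normConst (α : ℝ) (n : ℕ) : ℝ :=
  1 / Real.sqrt (∫ x in (0 : ℝ)..1, rawEigenfunction α n x ^ 2)

/-- The normalized eigenfunctions `Φ_{α,n}`, with `Φ_{α,0} = 1`. -/
noncomputable def eigenfunction (α : ℝ) (n : ℕ) (x : ℝ) : ℝ :=
  if n = 0 then 1 else normConst α n * rawEigenfunction α n x

/-- The scalar product of `L²(0,1)`. -/
noncomputable def innerL2 (f g : ℝ → ℝ) : ℝ := ∫ x in (0 : ℝ)..1, f x * g x

/-! ### Weighted Sobolev spaces

Their elements are represented by functions `ℝ → ℝ`, of which only the restriction to the interval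
matters. -/

/-- Lebesgue measure on `(0,1)`. -/
noncomputable def vol01 : Measure ℝ := volume.restrict (Set.Ioo (0 : ℝ) 1)

/-- `f ∈ H¹(0,1)`: `f` coincides a.e. with an absolutely continuous function on `[0,1]` whose
derivative is in `L²(0,1)`. -/
def MemH1 (f : ℝ → ℝ) : Prop :=
  ∃ g : ℝ → ℝ, AbsolutelyContinuousOnInterval g 0 1 ∧ f =ᵐ[vol01] g ∧ MemLp (deriv g) 2 vol01

/-- `u` is absolutely continuous on `[0,1]` if `α < 1`, and locally absolutely continuous in
`(0,1]` if `α ≥ 1`. -/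
def IsAC (α : ℝ) (u : ℝ → ℝ) : Prop :=
  if α < 1 then AbsolutelyContinuousOnInterval u 0 1
  else ∀ a : ℝ, 0 < a → a < 1 → AbsolutelyContinuousOnInterval u a 1

/-- The weighted derivative `x^(α/2) u_x`. -/
noncomputable def halfFlux (α : ℝ) (u : ℝ → ℝ) (x : ℝ) : ℝ := x ^ (α / 2) * deriv u x

/-- The flux `x^α u_x`. -/
noncomputable def flux (α : ℝ) (u : ℝ → ℝ) (x : ℝ) : ℝ := x ^ α * deriv u x

/-- `Au = (x^α u_x)_x`. -/
noncomputable def opA (α : ℝ) (u : ℝ → ℝ) : ℝ → ℝ := deriv (flux α u)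

/-- The space `H¹_α(0,1)`. -/
def H1 (α : ℝ) : Set (ℝ → ℝ) :=
  {u | MemLp u 2 vol01 ∧ IsAC α u ∧ MemLp (halfFlux α u) 2 vol01}

/-- The space `H²_α(0,1)`. -/
def H2 (α : ℝ) : Set (ℝ → ℝ) := {u | u ∈ H1 α ∧ MemH1 (flux α u)}

/-- The space `V²_α`: functions `μ ∈ H²_α(0,1)` with `x^(α/2) μ_x ∈ L^∞(0,1)` and, if `α ≥ 1`,
also `(x^α μ_x)_x ∈ L^∞(0,1)`. -/
def V2 (α : ℝ) : Set (ℝ → ℝ) :=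
  {μ | μ ∈ H2 α ∧ MemLp (halfFlux α μ) ⊤ vol01 ∧ (1 ≤ α → MemLp (opA α μ) ⊤ vol01)}

open Classical in
/-- The natural norm of `V²_α` (with values in `[0,∞]`, finite on `V²_α`): the norm of `H²_α(0,1)`
plus the `L^∞` norms of the quantities that are required to be bounded. -/
noncomputable def V2norm (α : ℝ) (μ : ℝ → ℝ) : ENNReal :=
  eLpNorm μ 2 vol01 + eLpNorm (halfFlux α μ) 2 vol01 + eLpNorm (opA α μ) 2 vol01
    + eLpNorm (halfFlux α μ) ⊤ vol01
    + (if 1 ≤ α then eLpNorm (opA α μ) ⊤ vol01 else 0)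

/-- The class `V^(adm)` of admissible potentials. -/
def Vadm (α : ℝ) : Set (ℝ → ℝ) :=
  {μ | μ ∈ V2 α ∧
    ∃ c : ℝ, 0 < c ∧ ∀ n : ℕ, c / eigenvalueStar α n ≤ |innerL2 μ (eigenfunction α n)|}

end DegenerateWave

/-!
Write `p = 2 - α`. The eigenfunctions are smooth functions of `x^p`: with the entire function
`G_a(z) = ∑ (-1)^m z^m / (m! Γ(m+a))` (`besselSeries`), `Φ_n` is a multiple of
`u(x) = G_{1/p}(Z x^p)` (`mode`), where `Z = j_n²/4` is a positive zero of `G_{1/p+1}` and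
`λ_n = p² Z`. The relations `G_a' = -G_{a+1}` and `z G_{a+2} = a G_{a+1} - G_a` are the eigenvalue
equation in the first-order form `u' = -p Z x^{-α} ψ`, `ψ' = p u` with `ψ(x) = x G_{1/p+1}(Z x^p)`
(`modeFlux`), which vanishes at both ends. All integrals of eigenfunctions that are needed have
explicit primitives in terms of `u` and `ψ`.

* Since `besselZero` is an infimum, one has to know that it is attained, and beyond the previous
  zero. Infinitely many zeros exist for `G_b`, `1 < b ≤ 2`, by a monotonicity argument
  (`not_pos_of_bessel_system`) and for larger `b` by Rolle's theorem (`exists_zero_besselSeries`);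
  they are simple since Lommel's integral `∫ u² = u(1)²/p` forces `u(1) ≠ 0`
  (`integral_mode_sq`, `mode_one_ne_zero`).
* Lommel's integral also gives `|Φ_n(1)| = √p`, and two integrations by parts give
  `λ_n ⟨x^p, Φ_n⟩ = p Φ_n(1)`; this is the explicit formula (`abs_innerL2_rpow`).
* For density, `μ` is perturbed to `μ + t x^p` with small `t > 0`. A function `μ` in `V²_α` is
  continuously differentiable in `(0,1)` with absolutely continuous flux (`exists_regularFlux`),
  and Green's formula (`RegularFlux.green`) gives
  `λ_n ⟨μ, Φ_n⟩ = [(x^α μ') Φ_n]_0^1 - ⟨(x^α μ')', Φ_n⟩`. The last term tends to `0` by Bessel's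
  inequality. The boundary term at `0` vanishes if `α > 0`, because `x^(α/2) μ'` is bounded; if
  `α = 0`, then `Φ_n(0) = ± Φ_n(1)`. Hence the numbers `λ_n ⟨μ, Φ_n⟩ / Φ_n(1)` have finitely many
  limit points (`exists_finite_limits`), and adding `t x^p` translates all of them by `t p`.
  All but countably many `t` keep them away from `0` (`exists_shift_bounded_below`).
-/

namespace DegenerateWave

open Filter Topology Set

/-! ### The entire functions behind the Bessel functions -/

/-- The entire function `G_a(z) = ∑ (-1)^m z^m / (m! Γ(m+a))`, for which
`J_ν(x) = (x/2)^ν G_{ν+1}(x²/4)` when `x > 0`. -/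
noncomputable def besselSeries (a z : ℝ) : ℝ :=
  ∑' m : ℕ, (-1 : ℝ) ^ m / ((Nat.factorial m : ℝ) * Real.Gamma ((m : ℝ) + a)) * z ^ m

lemma inv_Gamma_nat_add_le {a : ℝ} (ha : 0 < a) (m : ℕ) :
    (Real.Gamma ((m : ℝ) + a))⁻¹ ≤ (Real.Gamma a)⁻¹ + (Real.Gamma (1 + a))⁻¹ := by
  have h0 := inv_pos.2 (Real.Gamma_pos_of_pos ha)
  have h1 := inv_pos.2 (Real.Gamma_pos_of_pos (by linarith : 0 < 1 + a))
  rcases m with _ | m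
  · simp only [Nat.cast_zero, zero_add]
    linarith
  · induction m with
    | zero =>
      simp only [zero_add, Nat.cast_one]
      linarith
    | succ k ih =>
      refine le_trans ?_ ih
      have hk : (0 : ℝ) < ((k + 1 : ℕ) : ℝ) + a := by positivity
      have hk1 : (1 : ℝ) ≤ ((k + 1 : ℕ) : ℝ) + a := by push_cast; linarith [k.cast_nonneg (α := ℝ)]
      have e : (((k + 1 + 1 : ℕ) : ℝ) + a) = (((k + 1 : ℕ) : ℝ) + a) + 1 := by push_cast; ring
      rw [e, Real.Gamma_add_one hk.ne']
      have hp := Real.Gamma_pos_of_pos hk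
      apply inv_anti₀ hp
      nlinarith

lemma summable_besselSeries_norm {a : ℝ} (ha : 0 < a) (r : ℝ) :
    Summable fun m : ℕ =>
      ‖(-1 : ℝ) ^ m / ((Nat.factorial m : ℝ) * Real.Gamma ((m : ℝ) + a)) * r ^ m‖ := by
  refine Summable.of_nonneg_of_le (fun _ => norm_nonneg _) (fun m => ?_)
    ((Real.summable_pow_div_factorial |r|).mul_left
      ((Real.Gamma a)⁻¹ + (Real.Gamma (1 + a))⁻¹))
  have hp := Real.Gamma_pos_of_pos (by positivity : 0 < (m : ℝ) + a)
  have hb := inv_Gamma_nat_add_le ha m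
  have hm : (0 : ℝ) < Nat.factorial m := by positivity
  rw [norm_mul, norm_div, norm_pow, norm_neg, norm_one, one_pow, norm_mul, norm_pow,
    Real.norm_of_nonneg hm.le, Real.norm_of_nonneg hp.le, Real.norm_eq_abs]
  calc 1 / ((Nat.factorial m : ℝ) * Real.Gamma (m + a)) * |r| ^ m
      = (Real.Gamma (m + a))⁻¹ * (|r| ^ m / Nat.factorial m) := by field_simp
    _ ≤ _ := by gcongr

lemma summable_besselSeries {a : ℝ} (ha : 0 < a) (z : ℝ) :
    Summable fun m : ℕ =>
      (-1 : ℝ) ^ m / ((Nat.factorial m : ℝ) * Real.Gamma ((m : ℝ) + a)) * z ^ m :=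
  (summable_besselSeries_norm ha z).of_norm

/-- `G_a' = -G_{a+1}`. -/
lemma hasDerivAt_besselSeries {a : ℝ} (ha : 0 < a) (z : ℝ) :
    HasDerivAt (besselSeries a) (-besselSeries (a + 1) z) z := by
  set c : ℕ → ℝ := fun m => (-1 : ℝ) ^ m / ((Nat.factorial m : ℝ) * Real.Gamma ((m : ℝ) + a))
    with hc
  have hcs : ∀ (k : ℕ) (y : ℝ), c (k + 1) * (((k + 1 : ℕ) : ℝ) * y ^ k) =
      -((-1 : ℝ) ^ k / ((Nat.factorial k : ℝ) * Real.Gamma ((k : ℝ) + (a + 1))) * y ^ k) := by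
    intro k y
    have hp := Real.Gamma_pos_of_pos (by positivity : 0 < (k : ℝ) + (a + 1))
    have e : ((k + 1 : ℕ) : ℝ) + a = k + (a + 1) := by push_cast; ring
    simp only [hc, e, Nat.factorial_succ]
    push_cast
    field_simp
    ring
  set R : ℝ := |z| + 1 with hR
  have hz : z ∈ Metric.ball (0 : ℝ) R := by simp [hR]
  have hs1 : Summable fun m : ℕ => ‖c m * ((m : ℝ) * R ^ (m - 1))‖ := by
    rw [← summable_nat_add_iff 1]
    refine (summable_besselSeries_norm (by linarith : 0 < a + 1) R).congr fun k => ?_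
    simp only [Nat.add_sub_cancel]
    rw [hcs, norm_neg]
  have key := hasDerivAt_tsum_of_isPreconnected (𝕜 := ℝ)
    (u := fun m : ℕ => ‖c m * ((m : ℝ) * R ^ (m - 1))‖)
    (g := fun m y => c m * y ^ m)
    (g' := fun m y => c m * ((m : ℝ) * y ^ (m - 1))) hs1 Metric.isOpen_ball
    (convex_ball (0 : ℝ) R).isPreconnected
    (fun m y _ => (hasDerivAt_pow m y).const_mul (c m))
    (fun m y hy => by
      have hy' : |y| ≤ R := by
        have := Metric.mem_ball.1 hy
        rw [Real.dist_eq, sub_zero] at this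
        exact this.le
      rw [norm_mul, norm_mul, norm_mul, norm_mul, norm_pow, norm_pow, Real.norm_eq_abs y,
        Real.norm_eq_abs R, abs_of_nonneg (by positivity : 0 ≤ R)]
      gcongr) hz (summable_besselSeries ha z) hz
  convert! key using 1
  have hs : Summable fun m : ℕ => c m * ((m : ℝ) * z ^ (m - 1)) := by
    rw [← summable_nat_add_iff 1]
    refine (summable_besselSeries (by linarith : 0 < a + 1) z).neg.congr fun k => ?_
    simp only [Nat.add_sub_cancel]
    rw [hcs]
  rw [hs.tsum_eq_zero_add]
  simp only [Nat.cast_zero, zero_mul, mul_zero, zero_add, Nat.add_sub_cancel]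
  simp_rw [hcs]
  rw [tsum_neg]
  rfl

lemma continuous_besselSeries {a : ℝ} (ha : 0 < a) : Continuous (besselSeries a) :=
  continuous_iff_continuousAt.2 fun z => (hasDerivAt_besselSeries ha z).continuousAt

/-- The contiguous relation `z G_{a+2}(z) = a G_{a+1}(z) - G_a(z)`. -/
lemma mul_besselSeries_add_two {a : ℝ} (ha : 0 < a) (z : ℝ) :
    z * besselSeries (a + 1 + 1) z = a * besselSeries (a + 1) z - besselSeries a z := by
  have h1 := summable_besselSeries (by linarith : 0 < a + 1) z
  have h0 := summable_besselSeries ha z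
  unfold besselSeries
  rw [← tsum_mul_left, ← tsum_mul_left, ← (h1.mul_left a).tsum_sub h0,
    ((h1.mul_left a).sub h0).tsum_eq_zero_add]
  have hG : ∀ x : ℝ, 0 < x → Real.Gamma (x + 1) = x * Real.Gamma x :=
    fun x hx => Real.Gamma_add_one hx.ne'
  have e0 : a * ((-1 : ℝ) ^ 0 /
        ((Nat.factorial 0 : ℝ) * Real.Gamma (((0 : ℕ) : ℝ) + (a + 1))) * z ^ 0) -
      (-1 : ℝ) ^ 0 / ((Nat.factorial 0 : ℝ) * Real.Gamma (((0 : ℕ) : ℝ) + a)) * z ^ 0 = 0 := by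
    have := Real.Gamma_pos_of_pos ha
    simp only [Nat.cast_zero, zero_add, hG a ha]
    field_simp
    simp
  rw [e0, zero_add]
  congr 1
  ext k
  have hk : (0 : ℝ) < k + 1 + a := by positivity
  have hp := Real.Gamma_pos_of_pos hk
  have e1 : (k : ℝ) + (a + 1 + 1) = (k + 1 + a) + 1 := by ring
  have e2 : ((k + 1 : ℕ) : ℝ) + (a + 1) = (k + 1 + a) + 1 := by push_cast; ring
  have e3 : ((k + 1 : ℕ) : ℝ) + a = k + 1 + a := by push_cast; ring
  rw [e1, e2, e3, hG _ hk, Nat.factorial_succ]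
  push_cast
  field_simp
  ring

/-- The contiguous relation turns the derivative `-G_{a+2}` of `G_{a+1}` into
`z G_{a+1}' = G_a - a G_{a+1}`, so that `G_a` and `G_{a+1}` form a closed first-order system. -/
lemma hasDerivAt_besselSeries_add_one {a : ℝ} (ha : 0 < a) {z : ℝ} (hz : z ≠ 0) :
    HasDerivAt (besselSeries (a + 1))
      ((besselSeries a z - a * besselSeries (a + 1) z) / z) z := by
  convert! hasDerivAt_besselSeries (by linarith : 0 < a + 1) z using 1
  rw [div_eq_iff hz]
  linarith [mul_besselSeries_add_two ha z]

lemma besselSeries_zero (a : ℝ) : besselSeries a 0 = (Real.Gamma a)⁻¹ := by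
  unfold besselSeries
  rw [tsum_eq_single 0 (by intro m hm; simp [hm])]
  simp

lemma besselSeries_zero_pos {a : ℝ} (ha : 0 < a) : 0 < besselSeries a 0 := by
  rw [besselSeries_zero]
  exact inv_pos.2 (Real.Gamma_pos_of_pos ha)

/-- `J_ν(x) = (x/2)^ν G_{ν+1}(x²/4)`. -/
lemma besselJ_eq (ν : ℝ) {x : ℝ} (hx : 0 < x) :
    besselJ ν x = (x / 2) ^ ν * besselSeries (ν + 1) (x ^ 2 / 4) := by
  unfold besselJ besselSeries
  rw [← tsum_mul_left]
  congr 1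
  ext m
  have h2 : (x / 2) ^ (2 * (m : ℝ) + ν) = (x / 2) ^ ν * (x ^ 2 / 4) ^ m := by
    rw [Real.rpow_add (by positivity), mul_comm]
    congr 1
    have : (2 * (m : ℝ)) = ((2 * m : ℕ) : ℝ) := by push_cast; ring
    rw [this, Real.rpow_natCast, pow_mul]
    congr 1
    ring
  rw [h2, add_assoc]
  ring

/-! ### Positive zeros of Bessel functions -/

lemma antitoneOn_Ici_of_hasDerivAt {f f' : ℝ → ℝ} {b : ℝ}
    (hf : ∀ z, b ≤ z → HasDerivAt f (f' z) z) (hf' : ∀ z, b ≤ z → f' z ≤ 0) :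
    AntitoneOn f (Ici b) := by
  refine antitoneOn_of_deriv_nonpos (convex_Ici b)
    (fun z hz => (hf z hz).continuousAt.continuousWithinAt)
    (fun z hz => (hf z (interior_subset hz)).differentiableAt.differentiableWithinAt)
    (fun z hz => ?_)
  rw [(hf z (interior_subset hz)).deriv]
  exact hf' z (interior_subset hz)

/-- The system satisfied by `(G_a, G_{a+1})` has, for `a ≤ 1`, no solution whose second component
stays positive: `G` decreases, so either it becomes negative and drives `z^a H` to `-∞`, or
it stays nonnegative, `z^a H` increases, and `G' = -H ≤ -c/z` makes `G` tend to `-∞`. -/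
lemma not_pos_of_bessel_system {a z₀ : ℝ} (ha : 0 < a) (ha1 : a ≤ 1) (hz₀ : 1 ≤ z₀) {G H : ℝ → ℝ}
    (hG : ∀ z, z₀ ≤ z → HasDerivAt G (-H z) z)
    (hH : ∀ z, z₀ ≤ z → HasDerivAt H ((G z - a * H z) / z) z)
    (hpos : ∀ z, z₀ ≤ z → 0 < H z) : False := by
  have hGanti : AntitoneOn G (Ici z₀) :=
    antitoneOn_Ici_of_hasDerivAt hG fun z hz => by linarith [hpos z hz]
  have hpow : ∀ z, z₀ ≤ z → HasDerivAt (fun z : ℝ => z ^ a) (a * z ^ (a - 1)) z :=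
    fun z hz => Real.hasDerivAt_rpow_const (Or.inl (by linarith))
  have hsplit : ∀ z, z₀ ≤ z → z ^ a = z ^ (a - 1) * z := fun z hz => by
    have hz' : 0 < z := by linarith
    nth_rewrite 3 [← Real.rpow_one z]
    rw [← Real.rpow_add hz']
    ring_nf
  have hzH : ∀ z, z₀ ≤ z → HasDerivAt (fun z => z ^ a * H z) (z ^ (a - 1) * G z) z := by
    intro z hz
    have hz' : 0 < z := by linarith
    convert! (hpow z hz).mul (hH z hz) using 1
    rw [hsplit z hz]
    field_simp
    ring
  have hGnn : ∀ z, z₀ ≤ z → 0 ≤ G z := by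
    by_contra! hneg
    obtain ⟨z₁, hz₁, hGz₁⟩ := hneg
    set d := -G z₁ with hd
    have hanti : AntitoneOn (fun z => z ^ a * H z + d / a * z ^ a) (Ici z₁) := by
      refine antitoneOn_Ici_of_hasDerivAt (f' := fun z => z ^ (a - 1) * (G z + d)) ?_ ?_
      · intro z hz
        convert! (hzH z (hz₁.trans hz)).add ((hpow z (hz₁.trans hz)).const_mul (d / a)) using 1
        field_simp
      · intro z hz
        have := hGanti hz₁ (hz₁.trans hz) hz
        have hz' : 0 < z := by linarith
        exact mul_nonpos_of_nonneg_of_nonpos (by positivity) (by linarith)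
    have hev : ∀ᶠ z : ℝ in atTop, (z₁ ^ a * H z₁ + d / a * z₁ ^ a) < d / a * z ^ a :=
      ((tendsto_rpow_atTop ha).const_mul_atTop (div_pos (by linarith) ha)).eventually_gt_atTop _
    obtain ⟨z, hz1, hz2⟩ := (hev.and (eventually_ge_atTop z₁)).exists
    have h1 : z ^ a * H z + d / a * z ^ a ≤ _ := hanti (self_mem_Ici : z₁ ∈ Ici z₁) hz2 hz2
    have h2 : 0 < z ^ a * H z :=
      mul_pos (Real.rpow_pos_of_pos (by linarith) _) (hpos z (hz₁.trans hz2))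
    simp only at h1
    linarith
  have hmono : AntitoneOn (fun z => -(z ^ a * H z)) (Ici z₀) :=
    antitoneOn_Ici_of_hasDerivAt (fun z hz => (hzH z hz).neg) fun z hz => by
      have hz' : 0 < z := by linarith
      have := hGnn z hz
      have : 0 ≤ z ^ (a - 1) * G z := by positivity
      linarith
  set c := z₀ ^ a * H z₀ with hc
  have hcpos : 0 < c := mul_pos (Real.rpow_pos_of_pos (by linarith) _) (hpos z₀ le_rfl)
  have hanti : AntitoneOn (fun z => G z + c * Real.log z) (Ici z₀) := by
    refine antitoneOn_Ici_of_hasDerivAt (f' := fun z => -H z + c * z⁻¹) ?_ ?_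
    · intro z hz
      exact (hG z hz).add ((Real.hasDerivAt_log (by linarith)).const_mul c)
    · intro z hz
      have hz' : 0 < z := by linarith
      have h1 := hmono (self_mem_Ici : z₀ ∈ Ici z₀) hz hz
      have h2 : z ^ a ≤ z := by
        nth_rewrite 2 [← Real.rpow_one z]
        exact Real.rpow_le_rpow_of_exponent_le (by linarith) ha1
      have h3 := hpos z hz
      have h4 : c ≤ H z * z := by
        simp only at h1
        nlinarith
      have : c * z⁻¹ ≤ H z := by
        rw [← div_eq_mul_inv, div_le_iff₀ hz']
        exact h4
      linarith
  have hev : ∀ᶠ z : ℝ in atTop, G z₀ + c * Real.log z₀ < c * Real.log z :=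
    (Real.tendsto_log_atTop.const_mul_atTop hcpos).eventually_gt_atTop _
  obtain ⟨z, hz1, hz2⟩ := (hev.and (eventually_ge_atTop z₀)).exists
  have h1 := hanti (self_mem_Ici : z₀ ∈ Ici z₀) hz2 hz2
  have h2 := hGnn z hz2
  simp only at h1
  linarith

lemma exists_zero_besselSeries_of_le_one {a : ℝ} (ha : 0 < a) (ha1 : a ≤ 1) (z₀ : ℝ) :
    ∃ z, z₀ < z ∧ besselSeries (a + 1) z = 0 := by
  by_contra! hne
  set z₁ := max (z₀ + 1) 1 with hz₁
  have h1 : 1 ≤ z₁ := le_max_right _ _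
  have h0 : z₀ < z₁ := lt_of_lt_of_le (by linarith) (le_max_left _ _)
  have hcont := continuous_besselSeries (by linarith : 0 < a + 1)
  have hG : ∀ z, HasDerivAt (besselSeries a) (-besselSeries (a + 1) z) z :=
    hasDerivAt_besselSeries ha
  have hH : ∀ z, z₁ ≤ z → HasDerivAt (besselSeries (a + 1))
      ((besselSeries a z - a * besselSeries (a + 1) z) / z) z :=
    fun z hz => hasDerivAt_besselSeries_add_one ha (by linarith)
  have hsign : (∀ z, z₁ ≤ z → 0 < besselSeries (a + 1) z) ∨
      (∀ z, z₁ ≤ z → besselSeries (a + 1) z < 0) := by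
    by_contra! hcon
    obtain ⟨⟨u, hu, hu'⟩, ⟨v, hv, hv'⟩⟩ := hcon
    obtain ⟨w, hw, hw'⟩ := (isPreconnected_Ici (a := z₁)).intermediate_value hu hv
      hcont.continuousOn ⟨hu', hv'⟩
    exact hne w (h0.trans_le hw) hw'
  rcases hsign with hpos | hneg
  · exact not_pos_of_bessel_system ha ha1 h1 (fun z _ => hG z) hH hpos
  · refine not_pos_of_bessel_system ha ha1 h1 (G := fun z => -besselSeries a z)
      (H := fun z => -besselSeries (a + 1) z) (fun z _ => (hG z).neg) (fun z hz => ?_)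
      fun z hz => neg_pos.2 (hneg z hz)
    convert! (hH z hz).neg using 1
    ring

/-- `G_b` has arbitrarily large zeros for `b > 1`. By Rolle's theorem and `G_b' = -G_{b+1}`, the
property passes from `b` to `b + 1`. -/
lemma exists_zero_besselSeries {b : ℝ} (hb : 1 < b) (z₀ : ℝ) :
    ∃ z, z₀ < z ∧ besselSeries b z = 0 := by
  obtain ⟨n, hn⟩ := exists_nat_ge b
  induction n generalizing b z₀ with
  | zero =>
    rw [Nat.cast_zero] at hn
    linarith
  | succ n ih =>
    rcases le_or_gt b 2 with hb2 | hb2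
    · obtain ⟨z, hz⟩ := exists_zero_besselSeries_of_le_one (a := b - 1) (by linarith)
        (by linarith) z₀
      rw [sub_add_cancel] at hz
      exact ⟨z, hz⟩
    · have hn' : b - 1 ≤ n := by push_cast at hn; linarith
      obtain ⟨z₁, h1, h1'⟩ := ih (b := b - 1) (by linarith) z₀ hn'
      obtain ⟨z₂, h2, h2'⟩ := ih (b := b - 1) (by linarith) z₁ hn'
      have hpos : 0 < b - 1 := by linarith
      obtain ⟨c, hc, hc'⟩ := exists_hasDerivAt_eq_zero h2
        (continuous_besselSeries hpos).continuousOn (h1'.trans h2'.symm)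
        (fun z _ => hasDerivAt_besselSeries hpos z)
      rw [sub_add_cancel, neg_eq_zero] at hc'
      exact ⟨c, h1.trans hc.1, hc'⟩

/-! ### Integral identities for the eigenfunctions -/

/-- The eigenfunction `x ↦ G_{1/p}(Z x^p)`, `p = 2 - α`, for the eigenvalue `p² Z`, up to a constant
factor. Unlike the product of `x^((1-α)/2)` with a Bessel function, this form is continuous at
`0`. -/
noncomputable def mode (p Z x : ℝ) : ℝ := besselSeries (1 / p) (Z * x ^ p)

/-- `-1 / (p Z)` times the flux `x^(2-p) u'` of `u = mode p Z`. -/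
noncomputable def modeFlux (p Z x : ℝ) : ℝ := x * besselSeries (1 / p + 1) (Z * x ^ p)

lemma continuous_mul_rpow {p : ℝ} (hp : 0 < p) (Z : ℝ) : Continuous fun x : ℝ => Z * x ^ p :=
  continuous_const.mul (Real.continuous_rpow_const hp.le)

lemma continuous_mode {p : ℝ} (hp : 0 < p) (Z : ℝ) : Continuous (mode p Z) :=
  (continuous_besselSeries (by positivity)).comp (continuous_mul_rpow hp Z)

lemma continuous_modeFlux {p : ℝ} (hp : 0 < p) (Z : ℝ) : Continuous (modeFlux p Z) :=
  continuous_id.mul ((continuous_besselSeries (by positivity)).comp (continuous_mul_rpow hp Z))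

lemma mode_one (p Z : ℝ) : mode p Z 1 = besselSeries (1 / p) Z := by simp [mode]

lemma mode_zero {p : ℝ} (hp : 0 < p) (Z : ℝ) : mode p Z 0 = besselSeries (1 / p) 0 := by
  simp [mode, Real.zero_rpow hp.ne']

lemma modeFlux_zero (p Z : ℝ) : modeFlux p Z 0 = 0 := by simp [modeFlux]

lemma modeFlux_one (p Z : ℝ) : modeFlux p Z 1 = besselSeries (1 / p + 1) Z := by simp [modeFlux]

lemma hasDerivAt_mul_rpow (p Z : ℝ) {x : ℝ} (hx : 0 < x) :
    HasDerivAt (fun x : ℝ => Z * x ^ p) (Z * (p * (x ^ p / x))) x := by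
  have := (Real.hasDerivAt_rpow_const (p := p) (Or.inl hx.ne')).const_mul Z
  rwa [Real.rpow_sub_one hx.ne'] at this

/-- `mode' = -p Z x^(p-2) modeFlux`. -/
lemma hasDerivAt_mode {p : ℝ} (hp : 0 < p) (Z : ℝ) {x : ℝ} (hx : 0 < x) :
    HasDerivAt (mode p Z) (-(p * Z * (x ^ p / x ^ 2) * modeFlux p Z x)) x := by
  convert! (hasDerivAt_besselSeries (by positivity : 0 < 1 / p) (Z * x ^ p)).comp x
    (hasDerivAt_mul_rpow p Z hx) using 1
  unfold modeFlux
  field_simp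

lemma hasDerivAt_besselSeries_comp {p Z : ℝ} (hp : 0 < p) (hZ : 0 < Z) {x : ℝ} (hx : 0 < x) :
    HasDerivAt (fun x => besselSeries (1 / p + 1) (Z * x ^ p))
      ((p * mode p Z x - besselSeries (1 / p + 1) (Z * x ^ p)) / x) x := by
  have hxp : 0 < x ^ p := Real.rpow_pos_of_pos hx p
  convert! (hasDerivAt_besselSeries_add_one (by positivity : 0 < 1 / p)
    (mul_pos hZ hxp).ne').comp x (hasDerivAt_mul_rpow p Z hx) using 1
  unfold mode
  field_simp

/-- `modeFlux' = p mode`. -/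
lemma hasDerivAt_modeFlux {p Z : ℝ} (hp : 0 < p) (hZ : 0 < Z) {x : ℝ} (hx : 0 < x) :
    HasDerivAt (modeFlux p Z) (p * mode p Z x) x := by
  convert! (hasDerivAt_id x).mul (hasDerivAt_besselSeries_comp hp hZ hx) using 1
  simp only [id]
  field_simp
  ring

/-- `∫ x^p u` for an eigenfunction `u`: integrate by parts twice, using `(x^(2-p) (x^p)')' = p`. -/
lemma integral_rpow_mul_mode {p Z : ℝ} (hp : 0 < p) (hZ : 0 < Z) (h1 : modeFlux p Z 1 = 0) :
    ∫ x in (0 : ℝ)..1, x ^ p * mode p Z x = mode p Z 1 / (p * Z) := by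
  have cm := continuous_mode hp Z
  have cf := continuous_modeFlux hp Z
  have cp := Real.continuous_rpow_const hp.le
  rw [intervalIntegral.integral_eq_sub_of_hasDerivAt_of_le zero_le_one
    (f := fun x => x ^ p * modeFlux p Z x / p + (x * mode p Z x - modeFlux p Z x / p) / (p * Z))
    (f' := fun x => x ^ p * mode p Z x)
    (by fun_prop) (fun x hx => ?_) ((cp.mul cm).intervalIntegrable _ _)]
  · simp [modeFlux_zero, h1]
  · have hx0 := hx.1
    have hxp : 0 < x ^ p := Real.rpow_pos_of_pos hx0 p
    have hpow := hasDerivAt_mul_rpow p 1 hx0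
    simp only [one_mul] at hpow
    have hf := hasDerivAt_modeFlux hp hZ hx0
    convert! ((hpow.mul hf).div_const p).add ((((hasDerivAt_id x).mul
      (hasDerivAt_mode hp Z hx0)).sub (hf.div_const p)).div_const (p * Z)) using 1
    simp only [id]
    field_simp
    ring

/-- Lommel's integral for an eigenfunction. -/
lemma integral_mode_sq {p Z : ℝ} (hp : 0 < p) (hZ : 0 < Z) (h1 : modeFlux p Z 1 = 0) :
    ∫ x in (0 : ℝ)..1, mode p Z x ^ 2 = mode p Z 1 ^ 2 / p := by
  have cm := continuous_mode hp Z
  have cp := Real.continuous_rpow_const hp.le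
  have ch : Continuous fun x : ℝ => besselSeries (1 / p + 1) (Z * x ^ p) :=
    (continuous_besselSeries (by positivity)).comp (continuous_mul_rpow hp Z)
  rw [modeFlux_one] at h1
  rw [intervalIntegral.integral_eq_sub_of_hasDerivAt_of_le zero_le_one
    (f := fun x => (x * (mode p Z x ^ 2 + Z * x ^ p * besselSeries (1 / p + 1) (Z * x ^ p) ^ 2
      + (1 - 1 / p) * (mode p Z x * besselSeries (1 / p + 1) (Z * x ^ p)))) / p)
    (f' := fun x => mode p Z x ^ 2)
    (by fun_prop) (fun x hx => ?_) ((cm.pow 2).intervalIntegrable _ _)]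
  · simp [h1, -one_div]
  · have hx0 := hx.1
    have hxp : 0 < x ^ p := Real.rpow_pos_of_pos hx0 p
    have hm := hasDerivAt_mode hp Z hx0
    have hh := hasDerivAt_besselSeries_comp hp hZ hx0
    have hz := hasDerivAt_mul_rpow p Z hx0
    convert! (((hasDerivAt_id x).mul (((hm.pow 2).add (hz.mul (hh.pow 2))).add
      ((hm.mul hh).const_mul (1 - 1 / p)))).div_const p) using 1
    simp only [id, modeFlux, Pi.mul_apply, Pi.add_apply, Pi.pow_apply]
    field_simp
    ring

lemma integral_mode_mul_mode {p Z W : ℝ} (hp : 0 < p) (hZ : 0 < Z) (hW : 0 < W) (hZW : Z ≠ W)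
    (hZ1 : modeFlux p Z 1 = 0) (hW1 : modeFlux p W 1 = 0) :
    ∫ x in (0 : ℝ)..1, mode p Z x * mode p W x = 0 := by
  have cm := continuous_mode hp Z
  have cf := continuous_modeFlux hp Z
  have cm' := continuous_mode hp W
  have cf' := continuous_modeFlux hp W
  have hne : W - Z ≠ 0 := sub_ne_zero.2 hZW.symm
  rw [intervalIntegral.integral_eq_sub_of_hasDerivAt_of_le zero_le_one
    (f := fun x => (W * (mode p Z x * modeFlux p W x) - Z * (mode p W x * modeFlux p Z x))
      / (p * (W - Z)))
    (f' := fun x => mode p Z x * mode p W x)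
    (by fun_prop) (fun x hx => ?_) ((cm.mul cm').intervalIntegrable _ _)]
  · simp [hZ1, hW1, modeFlux_zero]
  · have hx0 := hx.1
    convert! ((((hasDerivAt_mode hp Z hx0).mul (hasDerivAt_modeFlux hp hW hx0)).const_mul W).sub
      (((hasDerivAt_mode hp W hx0).mul (hasDerivAt_modeFlux hp hZ hx0)).const_mul Z)).div_const
      (p * (W - Z)) using 1
    field_simp
    ring

lemma mode_one_ne_zero {p Z : ℝ} (hp : 0 < p) (hZ : 0 < Z) (h1 : modeFlux p Z 1 = 0) :
    mode p Z 1 ≠ 0 := by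
  intro h
  have hint := integral_mode_sq hp hZ h1
  have hpos : 0 < ∫ x in (0 : ℝ)..1, mode p Z x ^ 2 := by
    refine intervalIntegral.integral_pos zero_lt_one
      ((continuous_mode hp Z).pow 2).continuousOn (fun x _ => sq_nonneg _) ⟨0, by simp, ?_⟩
    rw [mode_zero hp]
    exact pow_pos (besselSeries_zero_pos (by positivity)) 2
  rw [hint, h] at hpos
  simp at hpos

/-- Positive zeros of `G_{a+1}` are simple. -/
lemma besselSeries_ne_zero_of_zero {a Z : ℝ} (ha : 0 < a) (hZ : 0 < Z)
    (h : besselSeries (a + 1) Z = 0) : besselSeries a Z ≠ 0 := by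
  have h1 : modeFlux (1 / a) Z 1 = 0 := by rw [modeFlux_one, one_div_one_div, h]
  have := mode_one_ne_zero (by positivity) hZ h1
  rwa [mode_one, one_div_one_div] at this

/-- For `α = 0` the eigenfunctions `cos (n π x)` have the same absolute value at both ends; here
this is read off the conserved quantity `G_{1/2}² + z G_{3/2}²`. -/
lemma mode_two_zero_sq {Z : ℝ} (hZ : 0 < Z) (h1 : modeFlux 2 Z 1 = 0) :
    mode 2 Z 0 ^ 2 = mode 2 Z 1 ^ 2 := by
  have h12 : (0 : ℝ) < 1 / 2 := by norm_num
  have c1 := continuous_besselSeries h12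
  have c2 := continuous_besselSeries (by norm_num : (0 : ℝ) < 1 / 2 + 1)
  have hftc := intervalIntegral.integral_eq_sub_of_hasDerivAt_of_le hZ.le
    (f := fun z => besselSeries (1 / 2) z ^ 2 + z * besselSeries (1 / 2 + 1) z ^ 2)
    (f' := fun _ => 0) (by fun_prop) (fun x hx => ?_) intervalIntegrable_const
  · rw [modeFlux_one] at h1
    rw [mode_zero (by norm_num), mode_one]
    rw [intervalIntegral.integral_zero, h1] at hftc
    linarith
  · have hx0 := hx.1
    convert! ((hasDerivAt_besselSeries h12 x).pow 2).add ((hasDerivAt_id x).mul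
      ((hasDerivAt_besselSeries_add_one h12 hx0.ne').pow 2)) using 1
    simp only [id, Pi.pow_apply]
    field_simp
    ring

/-! ### The zeros `besselZero` -/

lemma besselJ_eq_zero_iff (ν : ℝ) {x : ℝ} (hx : 0 < x) :
    besselJ ν x = 0 ↔ besselSeries (ν + 1) (x ^ 2 / 4) = 0 := by
  rw [besselJ_eq ν hx]
  have := Real.rpow_pos_of_pos (half_pos hx) ν
  simp [this.ne']

/-- The zeros of `x ↦ G_{ν+1}(x²/4)` do not accumulate at a nonnegative point. -/
lemma eventually_besselSeries_ne_zero {ν : ℝ} (hν : 0 < ν) {x₀ : ℝ} (hx₀ : 0 ≤ x₀) :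
    ∀ᶠ x in 𝓝[>] x₀, besselSeries (ν + 1) (x ^ 2 / 4) ≠ 0 := by
  have hcont : Continuous fun x : ℝ => besselSeries (ν + 1) (x ^ 2 / 4) :=
    (continuous_besselSeries (by linarith)).comp (by fun_prop)
  by_cases h : besselSeries (ν + 1) (x₀ ^ 2 / 4) = 0
  · have hx : 0 < x₀ := by
      refine lt_of_le_of_ne hx₀ ?_
      rintro rfl
      have := besselSeries_zero_pos (by linarith : 0 < ν + 1)
      norm_num at h
      linarith
    have hz : 0 < x₀ ^ 2 / 4 := by positivity
    have hd := (hasDerivAt_besselSeries_add_one hν hz.ne').comp x₀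
      ((hasDerivAt_pow 2 x₀).div_const 4)
    have hne := besselSeries_ne_zero_of_zero hν hz h
    refine (hd.eventually_ne (c := 0) ?_).filter_mono (nhdsWithin_mono _ fun y hy => ne_of_gt hy)
    rw [h]
    simpa [hx.ne'] using hne
  · exact (hcont.continuousAt.eventually_ne h).filter_mono nhdsWithin_le_nhds

lemma besselZero_step {ν : ℝ} (hν : 0 < ν) {x₀ : ℝ} (hx₀ : 0 ≤ x₀) :
    x₀ < sInf {x : ℝ | x₀ < x ∧ besselJ ν x = 0} ∧
      besselJ ν (sInf {x : ℝ | x₀ < x ∧ besselJ ν x = 0}) = 0 := by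
  obtain ⟨b, hb, hb'⟩ := (mem_nhdsGT_iff_exists_Ioo_subset).1
    (eventually_besselSeries_ne_zero hν hx₀)
  have hset : {x : ℝ | x₀ < x ∧ besselJ ν x = 0} =
      Ici b ∩ {x | besselSeries (ν + 1) (x ^ 2 / 4) = 0} := by
    ext x
    constructor
    · rintro ⟨h1, h2⟩
      rw [besselJ_eq_zero_iff ν (hx₀.trans_lt h1)] at h2
      refine ⟨?_, h2⟩
      by_contra hlt
      exact hb' ⟨h1, not_le.1 hlt⟩ h2
    · rintro ⟨h1, h2⟩
      have h3 : x₀ < x := lt_of_lt_of_le hb h1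
      exact ⟨h3, (besselJ_eq_zero_iff ν (hx₀.trans_lt h3)).2 h2⟩
  have hclosed : IsClosed {x : ℝ | x₀ < x ∧ besselJ ν x = 0} := by
    rw [hset]
    exact isClosed_Ici.inter (isClosed_eq
      ((continuous_besselSeries (by linarith)).comp (by fun_prop)) continuous_const)
  have hne : {x : ℝ | x₀ < x ∧ besselJ ν x = 0}.Nonempty := by
    obtain ⟨z, hz, hz'⟩ := exists_zero_besselSeries (b := ν + 1) (by linarith) (x₀ ^ 2 / 4)
    have hz0 : 0 ≤ z := le_trans (by positivity) hz.le
    have hlt : x₀ < 2 * Real.sqrt z := by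
      have : x₀ / 2 < Real.sqrt z := Real.lt_sqrt_of_sq_lt (by linarith)
      linarith
    refine ⟨2 * Real.sqrt z, hlt, (besselJ_eq_zero_iff ν (hx₀.trans_lt hlt)).2 ?_⟩
    rw [mul_pow, Real.sq_sqrt hz0]
    convert hz' using 2
    ring
  exact hclosed.csInf_mem hne ⟨x₀, fun x hx => hx.1.le⟩

lemma besselZero_nonneg {ν : ℝ} (hν : 0 < ν) (n : ℕ) : 0 ≤ besselZero ν n := by
  induction n with
  | zero => exact le_rfl
  | succ n ih => exact ih.trans (besselZero_step hν ih).1.le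

lemma besselZero_strictMono {ν : ℝ} (hν : 0 < ν) : StrictMono (besselZero ν) :=
  strictMono_nat_of_lt_succ fun n => (besselZero_step hν (besselZero_nonneg hν n)).1

lemma besselZero_pos {ν : ℝ} (hν : 0 < ν) {n : ℕ} (hn : 1 ≤ n) : 0 < besselZero ν n :=
  besselZero_strictMono hν (by omega : 0 < n)

lemma besselSeries_besselZero {ν : ℝ} (hν : 0 < ν) {n : ℕ} (hn : 1 ≤ n) :
    besselSeries (ν + 1) (besselZero ν n ^ 2 / 4) = 0 := by
  rw [← besselJ_eq_zero_iff ν (besselZero_pos hν hn)]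
  obtain ⟨m, rfl⟩ : ∃ m, n = m + 1 := ⟨n - 1, by omega⟩
  exact (besselZero_step hν (besselZero_nonneg hν m)).2

/-! ### The normalized eigenfunctions -/

/-- The number `Z_n = j_n² / 4`, for which `Φ_{α,n}` is proportional to `mode (2 - α) Z_n`. -/
noncomputable def eigenParam (α : ℝ) (n : ℕ) : ℝ := besselZero (order α + 1) n ^ 2 / 4

/-- The positive constant `K` with `Φ_{α,n} = K * mode (2 - α) Z_n`. -/
noncomputable def modeNormConst (α : ℝ) (n : ℕ) : ℝ :=
  Real.sqrt (2 - α) / |mode (2 - α) (eigenParam α n) 1|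

lemma order_add_one {α : ℝ} (hα2 : α < 2) : order α + 1 = 1 / (2 - α) := by
  have : 2 - α ≠ 0 := by linarith
  unfold order
  field_simp
  ring

lemma order_add_one_pos {α : ℝ} (hα2 : α < 2) : 0 < order α + 1 := by
  rw [order_add_one hα2]
  exact one_div_pos.2 (by linarith)

lemma eigenParam_pos {α : ℝ} (hα2 : α < 2) {n : ℕ} (hn : 1 ≤ n) : 0 < eigenParam α n := by
  have := besselZero_pos (order_add_one_pos hα2) hn
  unfold eigenParam
  positivity

lemma modeFlux_eigenParam {α : ℝ} (hα2 : α < 2) {n : ℕ} (hn : 1 ≤ n) :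
    modeFlux (2 - α) (eigenParam α n) 1 = 0 := by
  rw [modeFlux_one, ← order_add_one hα2]
  exact besselSeries_besselZero (order_add_one_pos hα2) hn

lemma mode_eigenParam_one_ne_zero {α : ℝ} (hα2 : α < 2) {n : ℕ} (hn : 1 ≤ n) :
    mode (2 - α) (eigenParam α n) 1 ≠ 0 :=
  mode_one_ne_zero (by linarith) (eigenParam_pos hα2 hn) (modeFlux_eigenParam hα2 hn)

lemma eigenParam_injective {α : ℝ} (hα2 : α < 2) : Function.Injective (eigenParam α) := by
  intro m n h
  have hν := order_add_one_pos hα2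
  have h2 : besselZero (order α + 1) m ^ 2 = besselZero (order α + 1) n ^ 2 := by
    unfold eigenParam at h
    linarith
  exact (besselZero_strictMono hν).injective
    ((sq_eq_sq₀ (besselZero_nonneg hν m) (besselZero_nonneg hν n)).1 h2)

lemma eigenvalue_eq (α : ℝ) {n : ℕ} (hn : 1 ≤ n) :
    eigenvalue α n = (2 - α) ^ 2 * eigenParam α n := by
  rw [eigenvalue, if_neg (by omega), kappa, eigenParam]
  ring

lemma eigenvalue_pos {α : ℝ} (hα2 : α < 2) {n : ℕ} (hn : 1 ≤ n) : 0 < eigenvalue α n := by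
  rw [eigenvalue_eq α hn]
  exact mul_pos (pow_pos (by linarith) 2) (eigenParam_pos hα2 hn)

lemma rawEigenfunction_eq {α : ℝ} (hα2 : α < 2) {n : ℕ} (hn : 1 ≤ n) {x : ℝ} (hx : 0 < x) :
    rawEigenfunction α n x = (besselZero (order α + 1) n / 2) ^ order α *
      mode (2 - α) (eigenParam α n) x := by
  have hj := besselZero_pos (order_add_one_pos hα2) hn
  have hα : 2 - α ≠ 0 := by linarith
  have hxk : 0 < x ^ ((2 - α) / 2) := Real.rpow_pos_of_pos hx _
  rw [rawEigenfunction, besselJ_eq _ (mul_pos hj hxk), mul_div_right_comm,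
    Real.mul_rpow (by positivity) hxk.le, ← Real.rpow_mul hx.le, mode, ← order_add_one hα2]
  have e1 : x ^ ((1 - α) / 2) * x ^ ((2 - α) / 2 * order α) = 1 := by
    rw [← Real.rpow_add hx, order, ← Real.rpow_zero x]
    congr 1
    field_simp
    ring
  have e2 : (besselZero (order α + 1) n * x ^ ((2 - α) / 2)) ^ 2 / 4 =
      eigenParam α n * x ^ (2 - α) := by
    rw [mul_pow, ← Real.rpow_natCast (x ^ ((2 - α) / 2)), ← Real.rpow_mul hx.le, eigenParam]
    have : (2 - α) / 2 * ((2 : ℕ) : ℝ) = 2 - α := by push_cast; ring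
    rw [this]
    ring
  rw [e2]
  linear_combination ((besselZero (order α + 1) n / 2) ^ order α *
    besselSeries (order α + 1) (eigenParam α n * x ^ (2 - α))) * e1

lemma eigenfunction_eq {α : ℝ} (hα2 : α < 2) {n : ℕ} (hn : 1 ≤ n) {x : ℝ} (hx : 0 < x) :
    eigenfunction α n x = modeNormConst α n * mode (2 - α) (eigenParam α n) x := by
  have hp : 0 < 2 - α := by linarith
  have hC : 0 < (besselZero (order α + 1) n / 2) ^ order α :=
    Real.rpow_pos_of_pos (half_pos (besselZero_pos (order_add_one_pos hα2) hn)) _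
  set C := (besselZero (order α + 1) n / 2) ^ order α
  have hint : ∫ x in (0 : ℝ)..1, rawEigenfunction α n x ^ 2 =
      C ^ 2 * (mode (2 - α) (eigenParam α n) 1 ^ 2 / (2 - α)) := by
    rw [← integral_mode_sq hp (eigenParam_pos hα2 hn) (modeFlux_eigenParam hα2 hn),
      ← intervalIntegral.integral_const_mul]
    refine intervalIntegral.integral_congr_ae (ae_of_all _ fun y hy => ?_)
    rw [uIoc_of_le zero_le_one] at hy
    rw [rawEigenfunction_eq hα2 hn hy.1, mul_pow]
  have hm : 0 < |mode (2 - α) (eigenParam α n) 1| :=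
    abs_pos.2 (mode_eigenParam_one_ne_zero hα2 hn)
  have hs : 0 < Real.sqrt (2 - α) := Real.sqrt_pos.2 hp
  rw [eigenfunction, if_neg (by omega), normConst, hint, rawEigenfunction_eq hα2 hn hx,
    Real.sqrt_mul (sq_nonneg _), Real.sqrt_sq hC.le, Real.sqrt_div (sq_nonneg _),
    Real.sqrt_sq_eq_abs, modeNormConst]
  change 1 / (C * _) * (C * _) = _
  field_simp

lemma innerL2_eigenfunction {α : ℝ} (hα2 : α < 2) {n : ℕ} (hn : 1 ≤ n) (f : ℝ → ℝ) :
    innerL2 f (eigenfunction α n) = modeNormConst α n *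
      ∫ x in (0 : ℝ)..1, f x * mode (2 - α) (eigenParam α n) x := by
  rw [innerL2, ← intervalIntegral.integral_const_mul]
  refine intervalIntegral.integral_congr_ae (ae_of_all _ fun y hy => ?_)
  rw [uIoc_of_le zero_le_one] at hy
  rw [eigenfunction_eq hα2 hn hy.1]
  ring

lemma innerL2_eigenfunction_zero (α : ℝ) (f : ℝ → ℝ) :
    innerL2 f (eigenfunction α 0) = ∫ x in (0 : ℝ)..1, f x := by
  simp [innerL2, eigenfunction]

lemma modeNormConst_mul_abs {α : ℝ} (hα2 : α < 2) {n : ℕ} (hn : 1 ≤ n) :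
    modeNormConst α n * |mode (2 - α) (eigenParam α n) 1| = Real.sqrt (2 - α) := by
  have hm : 0 < |mode (2 - α) (eigenParam α n) 1| :=
    abs_pos.2 (mode_eigenParam_one_ne_zero hα2 hn)
  rw [modeNormConst]
  field_simp

lemma rpow_three_halves {p : ℝ} (hp : 0 < p) : p ^ ((3 : ℝ) / 2) = p * Real.sqrt p := by
  rw [Real.sqrt_eq_rpow]
  nth_rewrite 2 [← Real.rpow_one p]
  rw [← Real.rpow_add hp]
  norm_num

/-- The signed coefficients of `x^(2-α)`. -/
lemma eigenvalue_mul_innerL2_rpow {α : ℝ} (hα2 : α < 2) {n : ℕ} (hn : 1 ≤ n) :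
    eigenvalue α n * innerL2 (fun x : ℝ => x ^ (2 - α)) (eigenfunction α n) =
      (2 - α) * (modeNormConst α n * mode (2 - α) (eigenParam α n) 1) := by
  have hp : 0 < 2 - α := by linarith
  have hZ := eigenParam_pos hα2 hn
  rw [innerL2_eigenfunction hα2 hn, integral_rpow_mul_mode hp hZ (modeFlux_eigenParam hα2 hn),
    eigenvalue_eq α hn]
  field_simp

lemma modeNormConst_nonneg (α : ℝ) (n : ℕ) : 0 ≤ modeNormConst α n := by
  unfold modeNormConst
  positivity

lemma abs_modeNormConst_mul {α : ℝ} (hα2 : α < 2) {n : ℕ} (hn : 1 ≤ n) :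
    |modeNormConst α n * mode (2 - α) (eigenParam α n) 1| = Real.sqrt (2 - α) := by
  rw [abs_mul, abs_of_nonneg (modeNormConst_nonneg α n), modeNormConst_mul_abs hα2 hn]

lemma abs_innerL2_rpow {α : ℝ} (hα2 : α < 2) {n : ℕ} (hn : 1 ≤ n) :
    |innerL2 (fun x : ℝ => x ^ (2 - α)) (eigenfunction α n)|
      = (2 - α) ^ ((3 : ℝ) / 2) / eigenvalue α n := by
  have hp : 0 < 2 - α := by linarith
  have hl := eigenvalue_pos hα2 hn
  have h := congrArg abs (eigenvalue_mul_innerL2_rpow hα2 hn)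
  rw [abs_mul, abs_mul, abs_of_pos hl, abs_of_pos hp, abs_modeNormConst_mul hα2 hn] at h
  rw [eq_div_iff hl.ne', rpow_three_halves hp, ← h, mul_comm]

lemma innerL2_rpow_zero {α : ℝ} (hα2 : α < 2) :
    innerL2 (fun x : ℝ => x ^ (2 - α)) (eigenfunction α 0) = 1 / (3 - α) := by
  rw [innerL2_eigenfunction_zero, integral_rpow (Or.inl (by linarith)),
    Real.zero_rpow (by linarith), Real.one_rpow, sub_zero]
  ring_nf

/-! ### Bessel's inequality -/

instance : IsFiniteMeasure vol01 := by
  unfold vol01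
  infer_instance

lemma integral_vol01 (f : ℝ → ℝ) : ∫ x, f x ∂vol01 = ∫ x in (0 : ℝ)..1, f x := by
  rw [intervalIntegral.integral_of_le zero_le_one, integral_Ioc_eq_integral_Ioo, vol01]

lemma memLp_vol01_of_continuous {f : ℝ → ℝ} (hf : Continuous f) (q : ENNReal) :
    MemLp f q vol01 := by
  obtain ⟨C, hC⟩ := isCompact_Icc.exists_bound_of_continuousOn (s := Icc (0 : ℝ) 1)
    hf.continuousOn
  refine MemLp.of_bound hf.aestronglyMeasurable C ?_
  rw [vol01]
  filter_upwards [ae_restrict_mem measurableSet_Ioo] with x hx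
  exact hC x (Ioo_subset_Icc_self hx)

/-- The Fourier coefficients of an `L²` function along the normalized eigenfunctions tend to `0`:
these are orthonormal. -/
lemma tendsto_coeff_zero {α : ℝ} (hα2 : α < 2) {f : ℝ → ℝ} (hf : MemLp f 2 vol01) :
    Tendsto (fun n : ℕ => modeNormConst α (n + 1) *
      ∫ x in (0 : ℝ)..1, f x * mode (2 - α) (eigenParam α (n + 1)) x) atTop (𝓝 0) := by
  have hp : 0 < 2 - α := by linarith
  have hmem : ∀ n : ℕ, MemLp (fun x => modeNormConst α (n + 1) *
      mode (2 - α) (eigenParam α (n + 1)) x) 2 vol01 :=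
    fun n => memLp_vol01_of_continuous (continuous_const.mul (continuous_mode hp _)) 2
  have hinner : ∀ (u v : ℝ → ℝ) (hu : MemLp u 2 vol01) (hv : MemLp v 2 vol01),
      inner ℝ (hu.toLp u) (hv.toLp v) = ∫ x in (0 : ℝ)..1, v x * u x := by
    intro u v hu hv
    rw [L2.inner_def, ← integral_vol01]
    refine integral_congr_ae ?_
    filter_upwards [hu.coeFn_toLp, hv.coeFn_toLp] with x h1 h2
    rw [h1, h2]
    rfl
  have horth : Orthonormal ℝ (fun n : ℕ => (hmem n).toLp _) := by
    rw [orthonormal_iff_ite]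
    intro i j
    rw [hinner]
    have hi : 1 ≤ i + 1 := by omega
    have hj : 1 ≤ j + 1 := by omega
    have e : ∀ x, modeNormConst α (j + 1) * mode (2 - α) (eigenParam α (j + 1)) x *
        (modeNormConst α (i + 1) * mode (2 - α) (eigenParam α (i + 1)) x) =
        (modeNormConst α (j + 1) * modeNormConst α (i + 1)) *
        (mode (2 - α) (eigenParam α (j + 1)) x * mode (2 - α) (eigenParam α (i + 1)) x) :=
      fun x => by ring
    simp_rw [e]
    rw [intervalIntegral.integral_const_mul]
    split_ifs with hij
    · subst hij
      simp_rw [← pow_two]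
      rw [integral_mode_sq hp (eigenParam_pos hα2 hi) (modeFlux_eigenParam hα2 hi),
        ← mul_div_assoc, ← mul_pow, ← sq_abs, abs_modeNormConst_mul hα2 hi, Real.sq_sqrt hp.le,
        div_self hp.ne']
    · rw [integral_mode_mul_mode hp (eigenParam_pos hα2 hj) (eigenParam_pos hα2 hi) _
        (modeFlux_eigenParam hα2 hj) (modeFlux_eigenParam hα2 hi), mul_zero]
      intro h
      have := eigenParam_injective hα2 h
      omega
  have h0 := (horth.inner_products_summable (hf.toLp f)).tendsto_atTop_zero
  have h1 : Tendsto (fun n : ℕ => |inner ℝ ((hmem n).toLp _) (hf.toLp f)|) atTop (𝓝 0) := by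
    have := h0.sqrt
    simpa [Real.sqrt_sq_eq_abs] using this
  refine ((tendsto_zero_iff_abs_tendsto_zero _).2 h1).congr fun n => ?_
  rw [hinner, ← intervalIntegral.integral_const_mul]
  congr 1
  ext x
  ring

/-! ### Regularity of the functions in `V²_α` -/

lemma absolutelyContinuousOnInterval_of_hasDerivAt {f f' : ℝ → ℝ} {a b : ℝ} (hab : a ≤ b)
    (hf : ∀ x ∈ Icc a b, HasDerivAt f (f' x) x) (hf' : ContinuousOn f' (Icc a b)) :
    AbsolutelyContinuousOnInterval f a b := by
  obtain ⟨C, hC⟩ := isCompact_Icc.exists_bound_of_continuousOn hf'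
  refine LipschitzOnWith.absolutelyContinuousOnInterval (K := C.toNNReal) ?_
  rw [uIcc_of_le hab]
  refine (convex_Icc a b).lipschitzOnWith_of_nnnorm_hasDerivWithin_le (f' := f')
    (fun x hx => (hf x hx).hasDerivWithinAt) fun x hx => ?_
  rw [← NNReal.coe_le_coe, coe_nnnorm]
  exact (hC x hx).trans (Real.le_coe_toNNReal C)

lemma absolutelyContinuousOnInterval_mode {p Z δ : ℝ} (hp : 0 < p) (hδ : 0 < δ)
    (hδ1 : δ ≤ 1) : AbsolutelyContinuousOnInterval (mode p Z) δ 1 := by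
  refine absolutelyContinuousOnInterval_of_hasDerivAt hδ1
    (fun x hx => hasDerivAt_mode hp Z (hδ.trans_le hx.1)) ?_
  have cf := continuous_modeFlux hp Z
  have cp := Real.continuous_rpow_const hp.le
  refine ((continuousOn_const.mul (cp.continuousOn.div (by fun_prop) fun _ hx => ?_)).mul
    cf.continuousOn).neg
  have := hδ.trans_le hx.1
  positivity

lemma absolutelyContinuousOnInterval_modeFlux {p Z δ : ℝ} (hp : 0 < p) (hZ : 0 < Z) (hδ : 0 < δ)
    (hδ1 : δ ≤ 1) : AbsolutelyContinuousOnInterval (modeFlux p Z) δ 1 :=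
  absolutelyContinuousOnInterval_of_hasDerivAt hδ1
    (fun _ hx => hasDerivAt_modeFlux hp hZ (hδ.trans_le hx.1))
    (continuous_const.mul (continuous_mode hp Z)).continuousOn

/-- An essentially bounded function that is continuous on an open set is bounded there. -/
lemma exists_bound_of_memLp_top {f : ℝ → ℝ} {U : Set ℝ} (hU : IsOpen U) (hf : ContinuousOn f U)
    (hm : MemLp f ⊤ (volume.restrict U)) : ∃ C, 0 ≤ C ∧ ∀ x ∈ U, |f x| ≤ C := by
  set C := (eLpNorm f ⊤ (volume.restrict U)).toReal with hC
  refine ⟨C, ENNReal.toReal_nonneg, ?_⟩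
  have hae : ∀ᵐ x ∂(volume.restrict U), |f x| ≤ C := by
    have h := ae_le_eLpNormEssSup (f := f) (μ := volume.restrict U)
    filter_upwards [h] with x hx
    rw [← eLpNorm_exponent_top, enorm_eq_nnnorm] at hx
    have := ENNReal.toReal_mono hm.2.ne hx
    rw [hC]
    simpa using this
  have heq : (fun x => max |f x| C) =ᵐ[volume.restrict U] fun _ => C := by
    filter_upwards [hae] with x hx
    exact max_eq_right hx
  have hon := Measure.eqOn_open_of_ae_eq heq hU (hf.abs.sup continuousOn_const) continuousOn_const
  intro x hx
  have h := hon hx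
  simp only at h
  rw [← h]
  exact le_max_left _ _

lemma integrable_mul_mode {α : ℝ} (hα2 : α < 2) {u : ℝ → ℝ} (hu : MemLp u 2 vol01) (Z : ℝ) :
    IntervalIntegrable (fun x => u x * mode (2 - α) Z x) volume 0 1 := by
  refine IntervalIntegrable.mul_continuousOn ?_ (continuous_mode (by linarith) Z).continuousOn
  rw [intervalIntegrable_iff_integrableOn_Ioo_of_le zero_le_one]
  exact hu.integrable one_le_two

/-- What membership in `V²_α` gives: a continuous representative `g` of the flux, which makes `μ`
continuously differentiable on `(0,1)` since `μ' = x^(-α) g` there. -/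
structure RegularFlux (α : ℝ) (μ g : ℝ → ℝ) : Prop where
  ac_flux : AbsolutelyContinuousOnInterval g 0 1
  ac_local : ∀ δ : ℝ, 0 < δ → δ < 1 → AbsolutelyContinuousOnInterval μ δ 1
  hasDerivAt : ∀ x ∈ Ioo (0 : ℝ) 1, HasDerivAt μ (x ^ (-α) * g x) x
  memLp_deriv : MemLp (deriv g) 2 vol01
  bound_flux : ∃ C, 0 ≤ C ∧ ∀ x ∈ Ioo (0 : ℝ) 1, |g x| ≤ C * x ^ (α / 2)

lemma IsAC.local {α : ℝ} {μ : ℝ → ℝ} (h : IsAC α μ) {δ : ℝ} (hδ : 0 < δ) (hδ1 : δ < 1) :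
    AbsolutelyContinuousOnInterval μ δ 1 := by
  unfold IsAC at h
  split_ifs at h with hα
  · refine h.mono ?_
    rw [uIcc_of_le hδ1.le, uIcc_of_le zero_le_one]
    exact Icc_subset_Icc_left hδ.le
  · exact h δ hδ hδ1

lemma exists_regularFlux {α : ℝ} {μ : ℝ → ℝ} (hμ : μ ∈ V2 α) : ∃ g, RegularFlux α μ g := by
  obtain ⟨⟨⟨-, hac, -⟩, g, hg, hgae, hg2⟩, hbd, -⟩ := hμ
  have hgc : ContinuousOn g (Icc 0 1) := by
    simpa [uIcc_of_le zero_le_one] using hg.continuousOn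
  have hwc : ContinuousOn (fun x : ℝ => x ^ (-α) * g x) (Ioc 0 1) := by
    refine ContinuousOn.mul (fun x hx => ?_) (hgc.mono Ioc_subset_Icc_self)
    exact (Real.continuousAt_rpow_const _ _ (Or.inl hx.1.ne')).continuousWithinAt
  have hder_ae : ∀ᵐ x, x ∈ Ioo (0 : ℝ) 1 → deriv μ x = x ^ (-α) * g x := by
    unfold vol01 at hgae
    have := (ae_restrict_iff' measurableSet_Ioo).1 hgae
    filter_upwards [this] with x hx hx01
    rw [← hx hx01, flux, ← mul_assoc, ← Real.rpow_add hx01.1]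
    simp
  have hint : ∀ x ∈ Ioo (0 : ℝ) 1, μ x = μ 1 - ∫ t in x..1, t ^ (-α) * g t := by
    intro x hx
    have h1 := (hac.local hx.1 hx.2).integral_deriv_eq_sub
    have h2 : ∫ t in x..1, t ^ (-α) * g t = ∫ t in x..1, deriv μ t := by
      rw [intervalIntegral.integral_of_le hx.2.le, intervalIntegral.integral_of_le hx.2.le,
        integral_Ioc_eq_integral_Ioo, integral_Ioc_eq_integral_Ioo]
      refine setIntegral_congr_ae measurableSet_Ioo ?_
      filter_upwards [hder_ae] with t ht htx
      exact (ht ⟨hx.1.trans htx.1, htx.2⟩).symm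
    rw [h2, h1]
    ring
  have hder : ∀ x ∈ Ioo (0 : ℝ) 1, HasDerivAt μ (x ^ (-α) * g x) x := by
    intro x hx
    have hii : IntervalIntegrable (fun t : ℝ => t ^ (-α) * g t) volume x 1 := by
      refine (hwc.mono ?_).intervalIntegrable
      rw [uIcc_of_le hx.2.le]
      exact fun t ht => ⟨hx.1.trans_le ht.1, ht.2⟩
    have hopen : Ioo (0 : ℝ) 1 ∈ 𝓝 x := isOpen_Ioo.mem_nhds hx
    have hca : ContinuousAt (fun t : ℝ => t ^ (-α) * g t) x :=
      (hwc.mono Ioo_subset_Ioc_self).continuousAt hopen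
    have hmeas : StronglyMeasurableAtFilter (fun t : ℝ => t ^ (-α) * g t) (𝓝 x) volume :=
      (hwc.mono Ioo_subset_Ioc_self).stronglyMeasurableAtFilter isOpen_Ioo x hx
    have h := (intervalIntegral.integral_hasDerivAt_left hii hmeas hca).const_sub (μ 1)
    rw [neg_neg] at h
    refine h.congr_of_eventuallyEq ?_
    filter_upwards [hopen] with y hy using hint y hy
  refine ⟨g, hg, fun δ h0 h1 => hac.local h0 h1, hder, hg2, ?_⟩
  have hhalf : ∀ x ∈ Ioo (0 : ℝ) 1, halfFlux α μ x = x ^ (-(α / 2)) * g x := by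
    intro x hx
    rw [halfFlux, (hder x hx).deriv, ← mul_assoc, ← Real.rpow_add hx.1]
    ring_nf
  obtain ⟨C, hC0, hC⟩ := exists_bound_of_memLp_top isOpen_Ioo (f := halfFlux α μ) (by
    refine ContinuousOn.congr (ContinuousOn.mul (fun x hx => ?_)
      (hgc.mono Ioo_subset_Icc_self)) hhalf
    exact (Real.continuousAt_rpow_const _ _ (Or.inl hx.1.ne')).continuousWithinAt) hbd
  refine ⟨C, hC0, fun x hx => ?_⟩
  have hxp : 0 < x ^ (α / 2) := Real.rpow_pos_of_pos hx.1 _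
  have h := hC x hx
  rw [hhalf x hx, abs_mul, Real.rpow_neg hx.1.le, abs_of_pos (inv_pos.2 hxp), inv_mul_le_iff₀ hxp,
    mul_comm] at h
  exact h

namespace RegularFlux

variable {α : ℝ} {μ g : ℝ → ℝ}

lemma continuousOn_flux (h : RegularFlux α μ g) : ContinuousOn g (Icc 0 1) := by
  simpa [uIcc_of_le zero_le_one] using h.ac_flux.continuousOn

lemma flux_eq (h : RegularFlux α μ g) {x : ℝ} (hx : x ∈ Ioo (0 : ℝ) 1) : flux α μ x = g x := by
  rw [flux, (h.hasDerivAt x hx).deriv, ← mul_assoc, ← Real.rpow_add hx.1]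
  simp

lemma opA_eq (h : RegularFlux α μ g) {x : ℝ} (hx : x ∈ Ioo (0 : ℝ) 1) : opA α μ x = deriv g x := by
  refine Filter.EventuallyEq.deriv_eq ?_
  filter_upwards [isOpen_Ioo.mem_nhds hx] with y hy using h.flux_eq hy

lemma memLp_opA (h : RegularFlux α μ g) : MemLp (opA α μ) 2 vol01 := by
  refine (memLp_congr_ae ?_).2 h.memLp_deriv
  rw [vol01]
  filter_upwards [ae_restrict_mem measurableSet_Ioo] with x hx using h.opA_eq hx

lemma flux_zero (h : RegularFlux α μ g) (hα : 0 < α) : g 0 = 0 := by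
  obtain ⟨C, -, hC⟩ := h.bound_flux
  have hev : ∀ᶠ x : ℝ in 𝓝[>] 0, x ∈ Ioo (0 : ℝ) 1 := Ioo_mem_nhdsGT zero_lt_one
  have hg : Tendsto g (𝓝[>] 0) (𝓝 (g 0)) :=
    ((h.continuousOn_flux 0 (by simp)).mono_of_mem_nhdsWithin
      (mem_of_superset (Ioo_mem_nhdsGT zero_lt_one) Ioo_subset_Icc_self))
  have hb : Tendsto (fun x : ℝ => C * x ^ (α / 2)) (𝓝[>] 0) (𝓝 0) := by
    have : Continuous fun x : ℝ => C * x ^ (α / 2) :=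
      continuous_const.mul (Real.continuous_rpow_const (by positivity))
    have h0 := this.tendsto 0
    rw [Real.zero_rpow (by positivity), mul_zero] at h0
    exact h0.mono_left nhdsWithin_le_nhds
  refine tendsto_nhds_unique hg (squeeze_zero_norm' ?_ hb)
  filter_upwards [hev] with x hx using hC x hx

lemma bounded (h : RegularFlux α μ g) (hα2 : α < 2) :
    ∃ M, ∀ x ∈ Ioo (0 : ℝ) 1, |μ x| ≤ M := by
  obtain ⟨C, hC0, hC⟩ := h.bound_flux
  have hr : 0 < 1 - α / 2 := by linarith
  refine ⟨|μ 1| + C / (1 - α / 2), fun x hx => ?_⟩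
  have h1 := (h.ac_local x hx.1 hx.2).integral_deriv_eq_sub
  have hii : IntervalIntegrable (fun t : ℝ => C * t ^ (-(α / 2))) volume x 1 :=
    (intervalIntegral.intervalIntegrable_rpow' (by linarith)).const_mul C
  have h2 : ‖∫ t in x..1, deriv μ t‖ ≤ ∫ t in x..1, C * t ^ (-(α / 2)) := by
    refine intervalIntegral.norm_integral_le_of_norm_le hx.2.le ?_ hii
    have hne : ∀ᵐ t : ℝ, t ≠ 1 := by simp [ae_iff, measure_singleton]
    filter_upwards [hne] with t ht1 ht
    have ht' : t ∈ Ioo (0 : ℝ) 1 := ⟨hx.1.trans ht.1, lt_of_le_of_ne ht.2 ht1⟩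
    rw [(h.hasDerivAt t ht').deriv, norm_mul, Real.norm_eq_abs, Real.norm_eq_abs,
      abs_of_pos (Real.rpow_pos_of_pos ht'.1 _)]
    calc t ^ (-α) * |g t| ≤ t ^ (-α) * (C * t ^ (α / 2)) := by
          gcongr
          · exact (Real.rpow_pos_of_pos ht'.1 _).le
          · exact hC t ht'
      _ = C * (t ^ (-α) * t ^ (α / 2)) := by ring
      _ = C * t ^ (-(α / 2)) := by rw [← Real.rpow_add ht'.1]; ring_nf
  have h3 : ∫ t in x..1, C * t ^ (-(α / 2)) ≤ C / (1 - α / 2) := by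
    rw [intervalIntegral.integral_const_mul, integral_rpow (Or.inl (by linarith)), Real.one_rpow,
      neg_add_eq_sub, mul_div_assoc']
    have : 0 ≤ C * x ^ (1 - α / 2) := mul_nonneg hC0 (Real.rpow_nonneg hx.1.le _)
    gcongr
    linarith
  rw [h1, Real.norm_eq_abs] at h2
  have h4 := abs_sub_abs_le_abs_sub (μ x) (μ 1)
  rw [abs_sub_comm] at h4
  linarith

/-- Green's formula for `μ` and an eigenfunction `u`:
`λ ∫ μ u = [(x^α μ') u]_0^1 - ∫ (x^α μ')' u`. -/
lemma green (h : RegularFlux α μ g) (hμ : MemLp μ 2 vol01) (hα2 : α < 2) {Z : ℝ} (hZ : 0 < Z)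
    (hZ1 : modeFlux (2 - α) Z 1 = 0) :
    (2 - α) ^ 2 * Z * ∫ x in (0 : ℝ)..1, μ x * mode (2 - α) Z x =
      g 1 * mode (2 - α) Z 1 - g 0 * mode (2 - α) Z 0 -
        ∫ x in (0 : ℝ)..1, deriv g x * mode (2 - α) Z x := by
  set p := 2 - α with hpdef
  have hp : 0 < p := by linarith
  have cm := continuous_mode hp Z
  have cf := continuous_modeFlux hp Z
  have hi1 : IntervalIntegrable (fun x => μ x * mode p Z x) volume 0 1 :=
    integrable_mul_mode hα2 hμ Z
  have hi2 : IntervalIntegrable (fun x => deriv g x * mode p Z x) volume 0 1 :=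
    h.ac_flux.intervalIntegrable_deriv.mul_continuousOn cm.continuousOn
  have hi : IntervalIntegrable (fun x => p ^ 2 * Z * (μ x * mode p Z x) + deriv g x * mode p Z x)
      volume 0 1 := (hi1.const_mul _).add hi2
  -- Absolute continuity of `μ` and of the mode may fail at `0`: integrate over `[δ, 1]` and let
  -- `δ → 0`. The boundary term `μ ψ` disappears in the limit because `μ` is bounded.
  have hcut : ∀ δ ∈ Ioo (0 : ℝ) 1,
      ∫ x in δ..1, p ^ 2 * Z * (μ x * mode p Z x) + deriv g x * mode p Z x =
        g 1 * mode p Z 1 - (p * Z * (μ δ * modeFlux p Z δ) + g δ * mode p Z δ) := by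
    intro δ hδ
    have aμ := h.ac_local δ hδ.1 hδ.2
    have ag : AbsolutelyContinuousOnInterval g δ 1 := by
      refine h.ac_flux.mono ?_
      rw [uIcc_of_le hδ.2.le, uIcc_of_le zero_le_one]
      exact Icc_subset_Icc_left hδ.1.le
    have am := absolutelyContinuousOnInterval_mode (Z := Z) hp hδ.1 hδ.2.le
    have af := absolutelyContinuousOnInterval_modeFlux hp hZ hδ.1 hδ.2.le
    have e1 := aμ.integral_deriv_mul_eq_sub af
    have e2 := ag.integral_deriv_mul_eq_sub am
    have i1 : IntervalIntegrable
        (fun x => deriv μ x * modeFlux p Z x + μ x * deriv (modeFlux p Z) x) volume δ 1 := (aμ.intervalIntegrable_deriv.mul_continuousOn cf.continuousOn).add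
      (af.intervalIntegrable_deriv.continuousOn_mul aμ.continuousOn)
    have i2 : IntervalIntegrable (fun x => deriv g x * mode p Z x + g x * deriv (mode p Z) x)
        volume δ 1 := (ag.intervalIntegrable_deriv.mul_continuousOn cm.continuousOn).add
      (am.intervalIntegrable_deriv.continuousOn_mul ag.continuousOn)
    have e3 : ∫ x in δ..1, p ^ 2 * Z * (μ x * mode p Z x) + deriv g x * mode p Z x =
        ∫ x in δ..1, (p * Z * (deriv μ x * modeFlux p Z x + μ x * deriv (modeFlux p Z) x) +
          (deriv g x * mode p Z x + g x * deriv (mode p Z) x)) := by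
      rw [intervalIntegral.integral_of_le hδ.2.le, intervalIntegral.integral_of_le hδ.2.le,
        integral_Ioc_eq_integral_Ioo, integral_Ioc_eq_integral_Ioo]
      refine setIntegral_congr_fun measurableSet_Ioo fun x hx => ?_
      have hx0 : 0 < x := hδ.1.trans hx.1
      have hpow : x ^ p / x ^ 2 = x ^ (-α) := by
        rw [← Real.rpow_natCast, ← Real.rpow_sub hx0, hpdef]
        congr 1
        push_cast
        ring
      rw [(h.hasDerivAt x ⟨hx0, hx.2⟩).deriv, (hasDerivAt_modeFlux hp hZ hx0).deriv,
        (hasDerivAt_mode hp Z hx0).deriv, hpow]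
      ring
    rw [e3, intervalIntegral.integral_add (i1.const_mul _) i2, intervalIntegral.integral_const_mul,
      e1, e2, hZ1]
    ring
  have hcontL : Tendsto (fun δ => ∫ x in δ..1, p ^ 2 * Z * (μ x * mode p Z x) +
      deriv g x * mode p Z x) (𝓝[>] 0) (𝓝 (∫ x in (0 : ℝ)..1, p ^ 2 * Z * (μ x * mode p Z x) +
      deriv g x * mode p Z x)) := by
    have hc := intervalIntegral.continuousOn_primitive_interval_left (μ := volume) (a := 0) (b := 1)
      (f := fun x => p ^ 2 * Z * (μ x * mode p Z x) + deriv g x * mode p Z x) (by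
        rw [uIcc_of_le zero_le_one, integrableOn_Icc_iff_integrableOn_Ioc]
        exact (intervalIntegrable_iff_integrableOn_Ioc_of_le zero_le_one).1 hi)
    rw [uIcc_of_le zero_le_one] at hc
    exact (hc 0 (by simp)).mono_of_mem_nhdsWithin
      (mem_of_superset (Ioo_mem_nhdsGT zero_lt_one) Ioo_subset_Icc_self)
  have hg0 : Tendsto g (𝓝[>] 0) (𝓝 (g 0)) :=
    ((h.continuousOn_flux 0 (by simp)).mono_of_mem_nhdsWithin
      (mem_of_superset (Ioo_mem_nhdsGT zero_lt_one) Ioo_subset_Icc_self))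
  have hm0 : Tendsto (mode p Z) (𝓝[>] 0) (𝓝 (mode p Z 0)) :=
    (cm.tendsto 0).mono_left nhdsWithin_le_nhds
  have hf0 : Tendsto (fun δ => μ δ * modeFlux p Z δ) (𝓝[>] 0) (𝓝 0) := by
    obtain ⟨M, hM⟩ := h.bounded hα2
    have hz : Tendsto (fun δ => M * |modeFlux p Z δ|) (𝓝[>] 0) (𝓝 0) := by
      have := ((continuous_const.mul cf.abs : Continuous fun δ => M * |modeFlux p Z δ|).tendsto
        0).mono_left (nhdsWithin_le_nhds (s := Ioi (0 : ℝ)))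
      simpa [modeFlux_zero, Pi.mul_def] using this
    refine squeeze_zero_norm' ?_ hz
    filter_upwards [Ioo_mem_nhdsGT (zero_lt_one (α := ℝ))] with δ hδ
    rw [norm_mul, Real.norm_eq_abs, Real.norm_eq_abs]
    exact mul_le_mul_of_nonneg_right (hM δ hδ) (abs_nonneg _)
  have hcontR : Tendsto (fun δ => ∫ x in δ..1, p ^ 2 * Z * (μ x * mode p Z x) +
      deriv g x * mode p Z x) (𝓝[>] 0)
      (𝓝 (g 1 * mode p Z 1 - (p * Z * 0 + g 0 * mode p Z 0))) := by
    refine (((hf0.const_mul (p * Z)).add (hg0.mul hm0)).const_sub (g 1 * mode p Z 1)).congr' ?_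
    filter_upwards [Ioo_mem_nhdsGT (zero_lt_one (α := ℝ))] with δ hδ using (hcut δ hδ).symm
  have hfin := tendsto_nhds_unique hcontL hcontR
  rw [intervalIntegral.integral_add (hi1.const_mul _) hi2, intervalIntegral.integral_const_mul]
    at hfin
  linarith

end RegularFlux

/-! ### `V²_α` is stable under adding multiples of `x^(2-α)` -/

lemma isAC_rpow {α : ℝ} (t : ℝ) : IsAC α fun x => t * x ^ (2 - α) := by
  unfold IsAC
  split_ifs with hα
  · exact absolutelyContinuousOnInterval_of_hasDerivAt zero_le_one
      (fun x _ => (Real.hasDerivAt_rpow_const (Or.inr (by linarith))).const_mul t)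
      (continuous_const.mul (continuous_const.mul
        (Real.continuous_rpow_const (by linarith)))).continuousOn
  · intro a ha ha1
    refine absolutelyContinuousOnInterval_of_hasDerivAt ha1.le
      (fun x hx => (Real.hasDerivAt_rpow_const (Or.inl (ha.trans_le hx.1).ne')).const_mul t)
      (continuousOn_const.mul (continuousOn_const.mul fun x hx => ?_))
    exact (Real.continuousAt_rpow_const _ _ (Or.inl (ha.trans_le hx.1).ne')).continuousWithinAt

lemma IsAC.add {α : ℝ} {u v : ℝ → ℝ} (hu : IsAC α u) (hv : IsAC α v) :
    IsAC α fun x => u x + v x := by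
  unfold IsAC at *
  split_ifs at * with hα
  · exact AbsolutelyContinuousOnInterval.add hu hv
  · exact fun a ha ha1 => AbsolutelyContinuousOnInterval.add (hu a ha ha1) (hv a ha ha1)

lemma hasDerivAt_const_mul_rpow (α t : ℝ) {x : ℝ} (hx : 0 < x) :
    HasDerivAt (fun x : ℝ => t * x ^ (2 - α)) (t * ((2 - α) * x ^ (1 - α))) x := by
  have := (Real.hasDerivAt_rpow_const (p := 2 - α) (Or.inl hx.ne')).const_mul t
  convert! this using 4
  ring

lemma RegularFlux.add_rpow_mem_V2 {α : ℝ} {μ g : ℝ → ℝ} (h : RegularFlux α μ g) (hμ : μ ∈ V2 α)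
    (hα2 : α < 2) (t : ℝ) : (fun x => μ x + t * x ^ (2 - α)) ∈ V2 α := by
  obtain ⟨⟨⟨hm, hac, hh⟩, -⟩, hbd, hA⟩ := hμ
  have hr : 0 < 1 - α / 2 := by linarith
  have hder : ∀ x ∈ Ioo (0 : ℝ) 1, deriv (fun x => μ x + t * x ^ (2 - α)) x =
      deriv μ x + t * ((2 - α) * x ^ (1 - α)) := fun x hx => by
    have h1 := h.hasDerivAt x hx
    rw [h1.deriv]
    exact (h1.add (hasDerivAt_const_mul_rpow α t hx.1)).deriv
  have hhalf : (fun x => halfFlux α μ x + t * (2 - α) * x ^ (1 - α / 2)) =ᵐ[vol01]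
      halfFlux α fun x => μ x + t * x ^ (2 - α) := by
    rw [vol01]
    filter_upwards [ae_restrict_mem measurableSet_Ioo] with x hx
    have e : x ^ (1 - α / 2) = x ^ (α / 2) * x ^ (1 - α) := by
      rw [← Real.rpow_add hx.1]
      ring_nf
    rw [halfFlux, halfFlux, hder x hx, e]
    ring
  have hflux : ∀ x ∈ Ioo (0 : ℝ) 1, flux α (fun x => μ x + t * x ^ (2 - α)) x =
      g x + t * (2 - α) * x := by
    intro x hx
    have e : x ^ α * x ^ (1 - α) = x := by
      rw [← Real.rpow_add hx.1]
      simp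
    rw [← h.flux_eq hx, flux, flux, hder x hx]
    linear_combination (t * (2 - α)) * e
  have hlin : Continuous fun x : ℝ => t * (2 - α) * x ^ (1 - α / 2) :=
    continuous_const.mul (Real.continuous_rpow_const hr.le)
  -- This holds only almost everywhere: where `g` is not differentiable, both derivatives are `0`.
  have hdg : deriv (fun x => g x + t * (2 - α) * x) =ᵐ[vol01]
      fun x => deriv g x + t * (2 - α) := by
    rw [vol01, EventuallyEq, ae_restrict_iff' measurableSet_Ioo]
    filter_upwards [h.ac_flux.ae_differentiableAt] with x hx hx01
    have hd := hx (by rw [uIcc_of_le zero_le_one]; exact Ioo_subset_Icc_self hx01)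
    have := hd.hasDerivAt.add ((hasDerivAt_id x).const_mul (t * (2 - α)))
    rw [mul_one] at this
    exact this.deriv
  have hopA : (fun x => opA α μ x + t * (2 - α)) =ᵐ[vol01]
      opA α fun x => μ x + t * x ^ (2 - α) := by
    refine EventuallyEq.trans ?_ (hdg.symm.trans ?_)
    · rw [vol01]
      filter_upwards [ae_restrict_mem measurableSet_Ioo] with x hx
      rw [h.opA_eq hx]
    · rw [vol01]
      filter_upwards [ae_restrict_mem measurableSet_Ioo] with x hx
      refine (Filter.EventuallyEq.deriv_eq ?_).symm
      filter_upwards [isOpen_Ioo.mem_nhds hx] with y hy using hflux y hy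
  refine ⟨⟨⟨hm.add (memLp_vol01_of_continuous (continuous_const.mul
    (Real.continuous_rpow_const (by linarith))) 2), hac.add (isAC_rpow t), ?_⟩, ?_⟩, ?_, ?_⟩
  · exact (memLp_congr_ae hhalf).1 (hh.add (memLp_vol01_of_continuous hlin 2))
  · refine ⟨fun x => g x + t * (2 - α) * x, ?_, ?_, ?_⟩
    · refine AbsolutelyContinuousOnInterval.add h.ac_flux
        (absolutelyContinuousOnInterval_of_hasDerivAt zero_le_one
          (fun x _ => (hasDerivAt_id x).const_mul (t * (2 - α))) continuousOn_const)
    · rw [vol01]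
      filter_upwards [ae_restrict_mem measurableSet_Ioo] with x hx using hflux x hx
    · exact (memLp_congr_ae hdg).2 (h.memLp_deriv.add (memLp_const _))
  · exact (memLp_congr_ae hhalf).1 (hbd.add (memLp_vol01_of_continuous hlin ⊤))
  · exact fun h1 => (memLp_congr_ae hopA).1 ((hA h1).add (memLp_const _))

lemma zero_mem_V2 (α : ℝ) : (fun _ => 0 : ℝ → ℝ) ∈ V2 α := by
  have hac : ∀ a b : ℝ, a ≤ b → AbsolutelyContinuousOnInterval (fun _ : ℝ => (0 : ℝ)) a b :=
    fun a b hab => absolutelyContinuousOnInterval_of_hasDerivAt hab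
      (fun x _ => hasDerivAt_const x (0 : ℝ)) continuousOn_const
  have hh : halfFlux α (fun _ => 0) = fun _ => 0 := by
    ext x
    simp [halfFlux]
  have hf : flux α (fun _ => 0) = fun _ => 0 := by
    ext x
    simp [flux]
  have hA : opA α (fun _ => 0) = fun _ => 0 := by
    ext x
    simp [opA, hf]
  refine ⟨⟨⟨memLp_const 0, ?_, ?_⟩, ?_⟩, ?_, fun _ => ?_⟩
  · unfold IsAC
    split_ifs
    · exact hac 0 1 zero_le_one
    · exact fun a _ ha1 => hac a 1 ha1.le
  · rw [hh]
    exact memLp_const 0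
  · refine ⟨fun _ => 0, hac 0 1 zero_le_one, by rw [hf], ?_⟩
    simp
  · rw [hh]
    exact memLp_const 0
  · rw [hA]
    exact memLp_const 0

lemma add_rpow_mem_V2 {α : ℝ} {μ : ℝ → ℝ} (hμ : μ ∈ V2 α) (hα2 : α < 2) (t : ℝ) :
    (fun x => μ x + t * x ^ (2 - α)) ∈ V2 α := by
  obtain ⟨g, h⟩ := exists_regularFlux hμ
  exact h.add_rpow_mem_V2 hμ hα2 t

lemma rpow_mem_V2 {α : ℝ} (hα2 : α < 2) : (fun x : ℝ => x ^ (2 - α)) ∈ V2 α := by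
  simpa using add_rpow_mem_V2 (zero_mem_V2 α) hα2 1

lemma V2norm_lt_top {α : ℝ} {μ : ℝ → ℝ} (hμ : μ ∈ V2 α) : V2norm α μ < ⊤ := by
  obtain ⟨g, h⟩ := exists_regularFlux hμ
  obtain ⟨⟨⟨hm, -, hh⟩, -⟩, hbd, hA⟩ := hμ
  unfold V2norm
  refine ENNReal.add_lt_top.2 ⟨ENNReal.add_lt_top.2 ⟨ENNReal.add_lt_top.2
    ⟨ENNReal.add_lt_top.2 ⟨hm.2, hh.2⟩, h.memLp_opA.2⟩, hbd.2⟩, ?_⟩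
  split_ifs with h1
  · exact (hA h1).2
  · exact ENNReal.zero_lt_top

lemma V2norm_const_mul (α c : ℝ) (μ : ℝ → ℝ) :
    V2norm α (fun x => c * μ x) = ENNReal.ofReal |c| * V2norm α μ := by
  have hh : halfFlux α (fun x => c * μ x) = c • halfFlux α μ := by
    ext x
    simp only [halfFlux, deriv_const_mul_field', Pi.smul_apply, smul_eq_mul]
    ring
  have hf : flux α (fun x => c * μ x) = fun x => c * flux α μ x := by
    ext x
    simp only [flux, deriv_const_mul_field']
    ring
  have hA : opA α (fun x => c * μ x) = c • opA α μ := by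
    ext x
    simp only [opA, hf, deriv_const_mul_field', Pi.smul_apply, smul_eq_mul]
  have hμ : (fun x => c * μ x) = c • μ := rfl
  have hc : ‖c‖ₑ = ENNReal.ofReal |c| := by rw [← Real.norm_eq_abs, ofReal_norm]
  unfold V2norm
  rw [hh, hA, hμ]
  simp only [eLpNorm_const_smul, hc, mul_add, mul_ite, mul_zero]

/-! ### Choosing an admissible perturbation -/

/-- A sequence with finitely many limit points can be translated by an arbitrarily small amount,
avoiding one prescribed value `e`, so that it stays away from `0`: the values to avoid form a
countable set. -/
lemma exists_shift_bounded_below {x ρ : ℕ → ℝ} {F : Set ℝ} (hF : F.Finite)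
    (hx : ∀ n, ∃ l ∈ F, |x n - l| ≤ ρ n) (hρ : Tendsto ρ atTop (𝓝 0)) (e : ℝ) {ε : ℝ}
    (hε : 0 < ε) :
    ∃ b, 0 < b ∧ b < ε ∧ b ≠ e ∧ ∃ c, 0 < c ∧ ∀ n, c ≤ |x n + b| := by
  have hcount : (range (fun n => -x n) ∪ (fun l => -l) '' F ∪ {e}).Countable :=
    ((countable_range _).union (hF.countable.image _)).union (countable_singleton e)
  obtain ⟨b, hb, hbε⟩ := (hcount.dense_compl ℝ).exists_mem_open isOpen_Ioo (nonempty_Ioo.2 hε)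
  simp only [mem_compl_iff, mem_union, mem_range, mem_image, mem_singleton_iff, not_or,
    not_exists, not_and] at hb
  obtain ⟨⟨hbx, hbF⟩, hbe⟩ := hb
  have hsmall : ∀ y : ℝ, y ≠ 0 → ∀ᶠ m in 𝓝[>] (0 : ℝ), m ≤ |y| := fun y hy =>
    (eventually_le_nhds (abs_pos.2 hy)).filter_mono nhdsWithin_le_nhds
  have hmF : ∀ᶠ m in 𝓝[>] (0 : ℝ), ∀ l ∈ F, m ≤ |l + b| :=
    (eventually_all_finite hF).2 fun l hl => hsmall _ fun h0 => hbF l hl (by linarith)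
  obtain ⟨m, hm, hm0⟩ := (hmF.and self_mem_nhdsWithin).exists
  have hm0' : 0 < m := hm0
  obtain ⟨N, hN⟩ := eventually_atTop.1 (hρ.eventually_lt_const (half_pos hm0'))
  have hcN : ∀ᶠ c in 𝓝[>] (0 : ℝ), ∀ n ∈ {n : ℕ | n < N}, c ≤ |x n + b| :=
    (eventually_all_finite (finite_lt_nat N)).2 fun n _ =>
      hsmall _ fun h0 => hbx n (by linarith)
  obtain ⟨c, hc, hc0⟩ := (hcN.and self_mem_nhdsWithin).exists
  refine ⟨b, hbε.1, hbε.2, hbe, min c (m / 2), lt_min hc0 (half_pos hm0'), fun n => ?_⟩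
  rcases lt_or_ge n N with hn | hn
  · exact (min_le_left _ _).trans (hc n hn)
  · obtain ⟨l, hl, hxl⟩ := hx n
    have h1 := hm l hl
    have h2 := hN n hn
    have h3 : |l + b| ≤ |x n + b| + |x n - l| := by
      have := abs_sub_abs_le_abs_sub (l + b) (x n + b)
      rw [abs_sub_comm, add_sub_add_right_eq_sub] at this
      linarith
    exact (min_le_right _ _).trans (by linarith)

lemma innerL2_add_rpow {α : ℝ} (hα2 : α < 2) {μ : ℝ → ℝ} (hμ : MemLp μ 2 vol01) (t : ℝ) (n : ℕ) :
    innerL2 (fun x => μ x + t * x ^ (2 - α)) (eigenfunction α n) =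
      innerL2 μ (eigenfunction α n) + t * innerL2 (fun x => x ^ (2 - α)) (eigenfunction α n) := by
  have hcp : Continuous fun x : ℝ => x ^ (2 - α) := Real.continuous_rpow_const (by linarith)
  rcases Nat.eq_zero_or_pos n with rfl | hn
  · have i1 : IntervalIntegrable μ volume 0 1 := by
      rw [intervalIntegrable_iff_integrableOn_Ioo_of_le zero_le_one]
      exact hμ.integrable one_le_two
    have i2 : IntervalIntegrable (fun x : ℝ => t * x ^ (2 - α)) volume 0 1 :=
      (continuous_const.mul hcp).intervalIntegrable _ _
    rw [innerL2_eigenfunction_zero, innerL2_eigenfunction_zero, innerL2_eigenfunction_zero,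
      intervalIntegral.integral_add i1 i2, intervalIntegral.integral_const_mul]
  · have i2 : IntervalIntegrable (fun x : ℝ => t * (x ^ (2 - α) *
        mode (2 - α) (eigenParam α n) x)) volume 0 1 :=
      (continuous_const.mul (hcp.mul (continuous_mode (by linarith) _))).intervalIntegrable _ _
    rw [innerL2_eigenfunction hα2 hn, innerL2_eigenfunction hα2 hn, innerL2_eigenfunction hα2 hn]
    simp_rw [add_mul, mul_assoc]
    rw [intervalIntegral.integral_add (integrable_mul_mode hα2 hμ _) i2,
      intervalIntegral.integral_const_mul]
    ring

lemma rpow_mem_Vadm {α : ℝ} (hα2 : α < 2) : (fun x : ℝ => x ^ (2 - α)) ∈ Vadm α := by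
  have hp : 0 < 2 - α := by linarith
  have h3 : 0 < 3 - α := by linarith
  refine ⟨rpow_mem_V2 hα2, min (1 / (3 - α)) ((2 - α) ^ ((3 : ℝ) / 2)),
    lt_min (by positivity) (by positivity), fun n => ?_⟩
  rcases Nat.eq_zero_or_pos n with rfl | hn
  · rw [innerL2_rpow_zero hα2, abs_of_pos (by positivity), eigenvalueStar, if_pos rfl, div_one]
    exact min_le_left _ _
  · rw [abs_innerL2_rpow hα2 hn, eigenvalueStar, if_neg (by omega)]
    exact div_le_div_of_nonneg_right (min_le_right _ _) (eigenvalue_pos hα2 hn).le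

/-- The coefficients `λ_n ⟨μ, Φ_n⟩`, normalized by the sign of `Φ_n(1)`, approach a finite set:
by Green's formula they differ from a combination of boundary values of the flux by a Fourier
coefficient of `(x^α μ')'`. -/
lemma exists_finite_limits {α : ℝ} (hα0 : 0 ≤ α) (hα2 : α < 2) {μ : ℝ → ℝ} (hμ : μ ∈ V2 α) :
    ∃ F : Set ℝ, F.Finite ∧ ∃ ρ : ℕ → ℝ, Tendsto ρ atTop (𝓝 0) ∧ ∀ n : ℕ, ∃ l ∈ F,
      |eigenvalue α (n + 1) * innerL2 μ (eigenfunction α (n + 1)) *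
        (modeNormConst α (n + 1) * mode (2 - α) (eigenParam α (n + 1)) 1) / Real.sqrt (2 - α)
        - l| ≤ ρ n := by
  obtain ⟨g, h⟩ := exists_regularFlux hμ
  have hp : 0 < 2 - α := by linarith
  set s := Real.sqrt (2 - α)
  have hs0 : 0 < s := Real.sqrt_pos.2 hp
  refine ⟨{(g 1 - g 0) * s, (g 1 + g 0) * s}, by simp, fun n => |modeNormConst α (n + 1) *
      ∫ x in (0 : ℝ)..1, deriv g x * mode (2 - α) (eigenParam α (n + 1)) x|, ?_, fun n => ?_⟩
  · simpa using (tendsto_coeff_zero hα2 h.memLp_deriv).abs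
  · have hn : 1 ≤ n + 1 := by omega
    have hZ := eigenParam_pos hα2 hn
    have hgreen := h.green hμ.1.1.1 hα2 hZ (modeFlux_eigenParam hα2 hn)
    have habs := abs_modeNormConst_mul hα2 hn
    have hmode := modeFlux_eigenParam hα2 hn
    rw [innerL2_eigenfunction hα2 hn, eigenvalue_eq α hn]
    set K := modeNormConst α (n + 1)
    set Z := eigenParam α (n + 1)
    set I := ∫ x in (0 : ℝ)..1, μ x * mode (2 - α) Z x
    set R := ∫ x in (0 : ℝ)..1, deriv g x * mode (2 - α) Z x
    set w := K * mode (2 - α) Z 1 with hw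
    have hww : w ^ 2 = s ^ 2 := by rw [← sq_abs, habs]
    have hcoef : (2 - α) ^ 2 * Z * (K * I) * w / s =
        g 1 * s - g 0 * (K * mode (2 - α) Z 0) * w / s - K * R * w / s := by
      have h1 : (2 - α) ^ 2 * Z * (K * I) =
          g 1 * w - g 0 * (K * mode (2 - α) Z 0) - K * R := by
        rw [hw]
        linear_combination K * hgreen
      rw [h1]
      field_simp
      linear_combination g 1 * hww
    have hR : |K * R * w / s| = |K * R| := by
      rw [abs_div, abs_mul _ w, habs, abs_of_pos hs0, mul_div_assoc, div_self hs0.ne', mul_one]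
    -- The boundary term at `0` vanishes for `α > 0`; for `α = 0`, `Φ_n(0) = ± Φ_n(1)`.
    have hzero : g 0 * (K * mode (2 - α) Z 0) = g 0 * w ∨
        g 0 * (K * mode (2 - α) Z 0) = -(g 0 * w) := by
      rcases hα0.eq_or_lt with rfl | hpos
      · rw [sub_zero] at hmode hw ⊢
        rcases sq_eq_sq_iff_eq_or_eq_neg.1 (mode_two_zero_sq hZ hmode) with h0 | h0
        · exact Or.inl (by rw [h0, hw])
        · exact Or.inr (by rw [h0, hw]; ring)
      · exact Or.inl (by rw [h.flux_zero hpos]; ring)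
    have hgs : g 0 * w * w / s = g 0 * s := by
      field_simp
      linear_combination g 0 * hww
    rcases hzero with h0 | h0
    · refine ⟨(g 1 - g 0) * s, by simp, ?_⟩
      rw [hcoef, h0, hgs, ← abs_neg]
      refine le_of_eq (Eq.trans (congrArg abs ?_) hR)
      ring
    · refine ⟨(g 1 + g 0) * s, by simp, ?_⟩
      rw [hcoef, h0, neg_mul, neg_div, hgs, ← abs_neg]
      refine le_of_eq (Eq.trans (congrArg abs ?_) hR)
      ring

lemma exists_Vadm_near {α : ℝ} (hα0 : 0 ≤ α) (hα2 : α < 2) {μ : ℝ → ℝ} (hμ : μ ∈ V2 α) {δ : ℝ}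
    (hδ : 0 < δ) : ∃ t, 0 < t ∧ t < δ ∧ (fun x => μ x + t * x ^ (2 - α)) ∈ Vadm α := by
  obtain ⟨F, hF, ρ, hρ, hx⟩ := exists_finite_limits hα0 hα2 hμ
  have hp : 0 < 2 - α := by linarith
  set s := Real.sqrt (2 - α)
  have hs0 : 0 < s := Real.sqrt_pos.2 hp
  have h3 : 0 < 3 - α := by linarith
  set m := innerL2 μ (eigenfunction α 0) with hm
  -- The value avoided here is the one for which the mean of the perturbed function vanishes.
  obtain ⟨b, hb0, hbδ, hbe, c, hc, hcb⟩ := exists_shift_bounded_below hF hx hρ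
    (-((3 - α) * m) * ((2 - α) * s)) (mul_pos hδ (mul_pos hp hs0))
  have hps := mul_pos hp hs0
  set t := b / ((2 - α) * s) with ht
  have hbt : b = t * ((2 - α) * s) := by rw [ht]; field_simp
  have hm0 : 0 < |m + t * (1 / (3 - α))| := by
    refine abs_pos.2 fun h0 => hbe ?_
    have : t = -((3 - α) * m) := by
      field_simp at h0
      linarith
    rw [hbt, this]
  refine ⟨t, div_pos hb0 hps, (div_lt_iff₀ hps).2 hbδ, add_rpow_mem_V2 hμ hα2 t,
    min c |m + t * (1 / (3 - α))|, lt_min hc hm0, fun n => ?_⟩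
  rw [innerL2_add_rpow hα2 hμ.1.1.1]
  rcases n with _ | n
  · rw [innerL2_rpow_zero hα2, eigenvalueStar, if_pos rfl, div_one]
    exact min_le_right _ _
  · have hn : 1 ≤ n + 1 := by omega
    have hl := eigenvalue_pos hα2 hn
    have hpow := eigenvalue_mul_innerL2_rpow hα2 hn
    have habs := abs_modeNormConst_mul hα2 hn
    have hcn := hcb n
    rw [eigenvalueStar, if_neg (by omega), div_le_iff₀ hl]
    set w := modeNormConst α (n + 1) * mode (2 - α) (eigenParam α (n + 1)) 1
    set A := innerL2 μ (eigenfunction α (n + 1))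
    set B := innerL2 (fun x => x ^ (2 - α)) (eigenfunction α (n + 1))
    have hww : w ^ 2 = s ^ 2 := by rw [← sq_abs, habs]
    have e : eigenvalue α (n + 1) * A * w / s + b = (A + t * B) * eigenvalue α (n + 1) * w / s := by
      rw [hbt]
      field_simp
      linear_combination (-(t * w)) * hpow - (t * (2 - α)) * hww
    rw [e, abs_div, abs_mul _ w, habs, abs_of_pos hs0, mul_div_assoc, div_self hs0.ne', mul_one,
      abs_mul, abs_of_pos hl] at hcn
    exact (min_le_left _ _).trans hcn

end DegenerateWave

theorem proposition3p4 (α : ℝ) (hα0 : 0 ≤ α) (hα2 : α < 2) :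
    (fun x : ℝ => x ^ (2 - α)) ∈ DegenerateWave.Vadm α ∧
    (∀ n : ℕ, 1 ≤ n →
      |DegenerateWave.innerL2 (fun x : ℝ => x ^ (2 - α)) (DegenerateWave.eigenfunction α n)|
        = (2 - α) ^ ((3 : ℝ) / 2) / DegenerateWave.eigenvalue α n) ∧
    (∀ μ ∈ DegenerateWave.V2 α, ∀ ε : ℝ, 0 < ε →
      ∃ η ∈ DegenerateWave.Vadm α,
        DegenerateWave.V2norm α (fun x => μ x - η x) < ENNReal.ofReal ε) := by
  refine ⟨DegenerateWave.rpow_mem_Vadm hα2, fun n hn => DegenerateWave.abs_innerL2_rpow hα2 hn,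
    fun μ hμ ε hε => ?_⟩
  have hfin := DegenerateWave.V2norm_lt_top (DegenerateWave.rpow_mem_V2 hα2)
  set N := DegenerateWave.V2norm α (fun x : ℝ => x ^ (2 - α)) with hN
  have hN0 : 0 < N.toReal + 1 := by positivity
  obtain ⟨t, ht0, htδ, ht⟩ := DegenerateWave.exists_Vadm_near hα0 hα2 hμ (div_pos hε hN0)
  refine ⟨_, ht, ?_⟩
  have e : (fun x => μ x - (μ x + t * x ^ (2 - α))) = fun x : ℝ => (-t) * x ^ (2 - α) := by
    ext x
    ring
  rw [e, DegenerateWave.V2norm_const_mul, abs_neg, abs_of_pos ht0, ← hN,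
    ← ENNReal.ofReal_toReal hfin.ne, ← ENNReal.ofReal_mul ht0.le]
  refine (ENNReal.ofReal_lt_ofReal_iff hε).2 ?_
  rw [lt_div_iff₀ hN0] at htδ
  linarith
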